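/- **Lemma 1.1.** Let $N\ge 0$, $c>0$, let $G$ be a locally integrable function on $\mathbb R^N\times\mathbb R$, and let $\Box_c u=\Delta_x u-c^{-2}\,\partial_t^2u$. Let $(F_i)_{i\in I}$ be a finite or countable family of sets (wave fronts) in $\mathbb R^N\times\mathbb R$ with union $S=\bigcup_i F_i$, and let $u:\mathbb R^N\times\mathbb R\to\mathbb R$ be a *classical solution* of $\Box_cu=G$ with fronts $F_i$, that is: 1. $u$ is $C^2$ near every point outside $S$, and $\Box_c u=G$ holds almost everywhere outside $S$; 2. $u$ and its first derivatives (taken outside $S$) are bounded near every point of $\mathbb R^N\times\mathbb R$; 3. for each $i$, almost every point $p=(x,t)$ of $F_i$ with respect to $N$-dimensional Hausdorff measure is regular in the following sense. Near $p$ the set $S$ is a surface $\{\Phi=0\}$ with $\Phi$ of class $C^1$, $\partial_t\Phi(p)<0$ and $c^{-2}(\partial_t\Phi(p))^2=\|\nabla_x\Phi(p)\|^2$ (so $S$ is characteristic at $p$ and the front moves with speed $c$ in the direction of its unit normal $n=\nabla_x\Phi(p)/\|\nabla_x\Phi(p)\|$ in $\mathbb R^N$); $u$ and its first derivatives have finite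 limits at $p$ from each of the two sides $\Phi>0$, $\Phi<0$; and the Hadamard conditions $$[u]=0,\qquad [\,\partial_tu+c\,n\cdot\nabla_xu\,]=0$$ hold at $p$, where $[f]=\lim_{\varepsilon\to+0}f(x+\varepsilon n,t)-\lim_{\varepsilon\to+0}f(x-\varepsilon n,t)$. Then $u$ is locally integrable, and the regular generalized function $\hat u\in D'(\mathbb R^N\times\mathbb R)$, $(\hat u,\varphi)=\int u\varphi\,dx\,dt$, is a generalized solution of $\Box_cu=G$: for every test function $\varphi\in C_c^\infty(\mathbb R^N\times\mathbb R)$, $$(\hat u,\Box_c\varphi)=\int G\,\varphi\,dx\,dt .$$ Moreover, no singular layer terms on the fronts arise: every first directional derivative of $\hat u$ in $D'$, and also $\Box_c\hat u$, is the regular generalized function given by the corresponding classical derivative of $u$ (defined almost everywhere), which is locally integrable. -/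

import Mathlib

open MeasureTheory Filter Topology TopologicalSpace
open scoped Distributions LineDeriv

noncomputable section

namespace WaveFronts

/-- Space-time `ℝ^N × ℝ`, with points `p = (x, t)`. -/
abbrev SpaceTime (N : ℕ) : Type := EuclideanSpace ℝ (Fin N) × ℝ

/-! ### Classical (pointwise) differential operators -/

/-- The partial derivative `∂f/∂t` at `p = (x, t)`. -/
def timeDeriv {N : ℕ} (f : SpaceTime N → ℝ) (p : SpaceTime N) : ℝ :=
  deriv (fun s : ℝ => f (p.1, s)) p.2

/-- The spatial gradient `(∂f/∂x_1, …, ∂f/∂x_N)` at `p = (x, t)`. -/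
def spaceGrad {N : ℕ} (f : SpaceTime N → ℝ) (p : SpaceTime N) : EuclideanSpace ℝ (Fin N) :=
  gradient (fun y : EuclideanSpace ℝ (Fin N) => f (y, p.2)) p.1

/-- The classical wave operator `Δ_x f - c⁻² ∂²f/∂t²` at `p = (x, t)`. -/
def dAlembert {N : ℕ} (c : ℝ) (f : SpaceTime N → ℝ) (p : SpaceTime N) : ℝ :=
  Laplacian.laplacian (fun y : EuclideanSpace ℝ (Fin N) => f (y, p.2)) p.1
    - (1 / c ^ 2) * timeDeriv (timeDeriv f) p

/-! ### Wave fronts, jumps, and the Hadamard conditions -/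

/-- `f` has the one-sided limits `f⁺ = lim_{ε → +0} f (x + ε n, t)` and
`f⁻ = lim_{ε → +0} f (x - ε n, t)` at `p = (x, t)`, and its jump `[f] = f⁺ - f⁻` is `j`. -/
def HasJump {N : ℕ} (f : SpaceTime N → ℝ) (p : SpaceTime N) (n : EuclideanSpace ℝ (Fin N))
    (j : ℝ) : Prop :=
  ∃ fplus fminus : ℝ,
    Tendsto (fun ε : ℝ => f (p.1 + ε • n, p.2)) (𝓝[>] 0) (𝓝 fplus) ∧
    Tendsto (fun ε : ℝ => f (p.1 - ε • n, p.2)) (𝓝[>] 0) (𝓝 fminus) ∧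
    fplus - fminus = j

/-- Near `p` the set `S` is the `C¹` hypersurface `Φ = 0`, whose normal vector
`ν = (∇_x Φ, ∂Φ/∂τ)`, `τ = c t`, satisfies at `p` the characteristic equation
`ν_τ² = ν_1² + … + ν_N²` and is oriented by `ν_τ < 0`. -/
structure IsCharacteristicSurfaceAt {N : ℕ} (c : ℝ) (S : Set (SpaceTime N))
    (Φ : SpaceTime N → ℝ) (p : SpaceTime N) : Prop where
  smooth : ContDiffAt ℝ 1 Φ p
  surface : ∀ᶠ q in 𝓝 p, (q ∈ S ↔ Φ q = 0)
  orientation : timeDeriv Φ p < 0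
  characteristic : (timeDeriv Φ p / c) ^ 2 = ‖spaceGrad Φ p‖ ^ 2

/-- The unit normal `n = ∇_x Φ / ‖∇_x Φ‖` of the moving front `Φ(·, t) = 0` in `ℝ^N`; when
`∂Φ/∂t < 0` it points in the direction of propagation. -/
def frontNormal {N : ℕ} (Φ : SpaceTime N → ℝ) (p : SpaceTime N) : EuclideanSpace ℝ (Fin N) :=
  ‖spaceGrad Φ p‖⁻¹ • spaceGrad Φ p

/-- `f` has a limit at `p` from each of the two sides `Φ > 0`, `Φ < 0` of the surface `Φ = 0`. -/
def HasSideLimits {N : ℕ} {V : Type*} [TopologicalSpace V] (Φ : SpaceTime N → ℝ)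
    (f : SpaceTime N → V) (p : SpaceTime N) : Prop :=
  (∃ a : V, Tendsto f (𝓝[{q | 0 < Φ q}] p) (𝓝 a)) ∧
  (∃ b : V, Tendsto f (𝓝[{q | Φ q < 0}] p) (𝓝 b))

/-- `p` is a regular point of the front set `S` for `u`: near `p` the set `S` is a `C¹`
characteristic hypersurface, `u` and its first derivatives have limits at `p` from both sides,
and the Hadamard conditions `[u] = 0` and `[∂u/∂t + c n · ∇_x u] = 0` hold at `p`. -/
def IsHadamardPoint {N : ℕ} (c : ℝ) (S : Set (SpaceTime N)) (u : SpaceTime N → ℝ)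
    (p : SpaceTime N) : Prop :=
  ∃ Φ : SpaceTime N → ℝ,
    IsCharacteristicSurfaceAt c S Φ p ∧
    HasSideLimits Φ u p ∧
    HasSideLimits Φ (fderiv ℝ u) p ∧
    HasJump u p (frontNormal Φ p) 0 ∧
    HasJump (fun q => timeDeriv u q + c * inner ℝ (frontNormal Φ p) (spaceGrad u q)) p
      (frontNormal Φ p) 0

/-- `u` is a classical solution of `□_c u = G` with wave fronts `F i`. Here `μH[N]` is the
`N`-dimensional Hausdorff measure of `ℝ^{N+1}` (surface area, up to a factor bounded above and
below): almost every point of each front is regular, the exceptional points being vertices, edges,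
and crossings of fronts. -/
structure IsClassicalSolution {N : ℕ} {ι : Type*} (c : ℝ) (G : SpaceTime N → ℝ)
    (F : ι → Set (SpaceTime N)) (u : SpaceTime N → ℝ) : Prop where
  contDiffAt : ∀ p, p ∉ ⋃ i, F i → ContDiffAt ℝ 2 u p
  locallyBounded : ∀ p, ∃ M : ℝ, ∀ᶠ q in 𝓝 p, q ∉ ⋃ i, F i → |u q| ≤ M ∧ ‖fderiv ℝ u q‖ ≤ M
  hadamard : ∀ i, ∀ᵐ p ∂(μH[(N : ℝ)] : Measure (SpaceTime N)),
    p ∈ F i → IsHadamardPoint c (⋃ i, F i) u p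
  equation : ∀ᵐ p : SpaceTime N, p ∉ ⋃ i, F i → dAlembert c u p = G p

/-! ### Generalized functions -/

/-- The space `D'(ℝ^N × ℝ)` of generalized functions (Mathlib's distributions). -/
abbrev GenFun (N : ℕ) : Type := 𝓓'((⊤ : Opens (SpaceTime N)), ℝ)

/-- The regular generalized function `φ ↦ ∫ f φ dx dt` of a locally integrable `f`. -/
def regular {N : ℕ} (f : SpaceTime N → ℝ) : GenFun N :=
  UniformConvergenceCLM.ofFun (RingHom.id ℝ) ℝ _
    (TestFunction.integralAgainstBilinCLM (ContinuousLinearMap.mul ℝ ℝ) volume f)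

theorem regular_apply {N : ℕ} {f : SpaceTime N → ℝ} (hf : LocallyIntegrable f)
    (φ : 𝓓((⊤ : Opens (SpaceTime N)), ℝ)) : regular f φ = ∫ p, f p * φ p := by
  have h : LocallyIntegrableOn f ((⊤ : Opens (SpaceTime N)) : Set (SpaceTime N)) volume :=
    hf.locallyIntegrableOn _
  refine (TestFunction.integralAgainstBilinCLM_eq_integral h).trans ?_
  simp [mul_comm]

/-- The wave operator `∑_j ∂_{x_j}² - c⁻² ∂_t²` on any space with a notion of directional
derivative; it is used on test functions and on generalized functions. -/
def waveOp (N : ℕ) {V : Type*} [AddCommGroup V] [Module ℝ V] [LineDeriv (SpaceTime N) V V]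
    (c : ℝ) (f : V) : V :=
  (∑ j : Fin N, ∂_{((EuclideanSpace.single j 1, 0) : SpaceTime N)}
      (∂_{((EuclideanSpace.single j 1, 0) : SpaceTime N)} f : V))
    - (1 / c ^ 2 : ℝ) • (∂_{((0, 1) : SpaceTime N)} (∂_{((0, 1) : SpaceTime N)} f : V) : V)

/-- `T` is a generalized solution of `□_c u = G`: `(T, □_c φ) = (G, φ)` for all test
functions `φ`. -/
def IsGeneralizedSolution {N : ℕ} (c : ℝ) (G : SpaceTime N → ℝ) (T : GenFun N) : Prop :=
  ∀ φ : 𝓓((⊤ : Opens (SpaceTime N)), ℝ), T (waveOp N c φ) = regular G φ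

end WaveFronts

end

noncomputable section

namespace WaveFronts

/-! ### The weak divergence identity -/

section WeakDiv

/-! The wave operator is a divergence: `□_c u = div (A∇u)` in space-time, with `A` the constant
diagonal matrix `diag(1, …, 1, -c⁻²)`. Both claims about derivatives of `û` therefore say that a
locally bounded field has its classical divergence also in the weak sense: the field `u w` with
divergence `∂_w u`, and the field `A∇u` with divergence `G` (`hasWeakDiv_smul`,
`hasWeakDiv_waveGrad`).

The only obstruction at a regular point of a front `Φ = 0` is a layer with density proportional to
the jump of the normal component `dΦ(V)`. For `V = u w` it vanishes because `[u] = 0`. For `V =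
A∇u`, symmetry of `A` gives `dΦ(A∇u) = du(A∇Φ)`. The characteristic equation makes `A∇Φ` a positive
multiple of `(c n, 1)`, a direction tangent to the front, so the jump is a multiple of `[∂_t u + c
n·∇_x u] = 0` (`isTransmissionPoint_waveGrad`).

The analytic part is `hasWeakDiv_univ_of_transmission`. Off the fronts the identity is integration
by parts. Near a regular point the front is a `C¹` graph `t = ψ(x)`, which is cut out by functions
of `k(t - ψ(x))` (`HasWeakDiv.of_diff_graph`). The points without a good neighbourhood form a closed
set that is null for `N`-dimensional Hausdorff measure. Cut-offs whose gradients tend to `0` in `L¹`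
remove it, since the field is bounded (`HasWeakDiv.of_compl`). -/

theorem integrable_mul_of_compact {E : Type*} [NormedAddCommGroup E] [MeasurableSpace E]
    [BorelSpace E] {μ : Measure E} {g ζ : E → ℝ} (hζ : Continuous ζ) (hc : HasCompactSupport ζ)
    (hg : LocallyIntegrable g μ) : Integrable (fun p => ζ p * g p) μ :=
  hg.integrable_smul_left_of_hasCompactSupport hζ hc

theorem fderiv_mul_apply {E : Type*} [NormedAddCommGroup E] [NormedSpace ℝ E]
    {ζ χ : E → ℝ} (hζ : ContDiff ℝ 1 ζ) (hχ : ContDiff ℝ 1 χ) (p v : E) :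
    fderiv ℝ (fun q => χ q * ζ q) p v = χ p * fderiv ℝ ζ p v + ζ p * fderiv ℝ χ p v := by
  have h1 := (hζ.differentiable one_ne_zero) p
  have h2 := (hχ.differentiable one_ne_zero) p
  rw [fderiv_fun_mul h2 h1]
  simp

variable {E : Type*} [NormedAddCommGroup E] [NormedSpace ℝ E] [MeasurableSpace E]

/-- `g` is the divergence of the vector field `V` on `W`, tested against `C¹` functions with
compact support in `W`. -/
def HasWeakDiv (μ : Measure E) (V : E → E) (g : E → ℝ) (W : Set E) : Prop :=
  ∀ ζ : E → ℝ, ContDiff ℝ 1 ζ → HasCompactSupport ζ → tsupport ζ ⊆ W →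
    ∫ p, fderiv ℝ ζ p (V p) ∂μ = - ∫ p, ζ p * g p ∂μ

variable {μ : Measure E} {V : E → E} {g : E → ℝ}

theorem HasWeakDiv.mono {W W' : Set E} (h : HasWeakDiv μ V g W) (hW : W' ⊆ W) :
    HasWeakDiv μ V g W' :=
  fun ζ h1 h2 h3 => h ζ h1 h2 (h3.trans hW)

theorem HasWeakDiv.congr_ae {g' : E → ℝ} {W : Set E} (h : HasWeakDiv μ V g W)
    (hg : ∀ᵐ p ∂μ, p ∈ W → g p = g' p) : HasWeakDiv μ V g' W := by
  intro ζ hζ hc hs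
  rw [h ζ hζ hc hs]
  congr 1
  refine integral_congr_ae ?_
  filter_upwards [hg] with p hp
  by_cases hpζ : p ∈ tsupport ζ
  · rw [hp (hs hpζ)]
  · simp [image_eq_zero_of_notMem_tsupport hpζ]

variable [BorelSpace E] [FiniteDimensional ℝ E]

theorem integrable_clm_apply {L : E → E →L[ℝ] ℝ} (hL : Continuous L) (hc : HasCompactSupport L)
    (hV : LocallyIntegrable V μ) : Integrable (fun p => L p (V p)) μ := by
  have h1 : Integrable (fun p => ‖L p‖ • V p) μ :=
    hV.integrable_smul_left_of_hasCompactSupport hL.norm hc.norm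
  refine h1.mono 
    (isBoundedBilinearMap_apply.continuous.comp_aestronglyMeasurable
      (hL.aestronglyMeasurable.prodMk hV.aestronglyMeasurable)) ?_
  refine Eventually.of_forall fun p => ?_
  rw [norm_smul, norm_norm]
  exact (L p).le_opNorm _

theorem integrable_fderiv_apply {ζ : E → ℝ} (hζ : ContDiff ℝ 1 ζ) (hc : HasCompactSupport ζ)
    (hV : LocallyIntegrable V μ) : Integrable (fun p => fderiv ℝ ζ p (V p)) μ :=
  integrable_clm_apply (hζ.continuous_fderiv one_ne_zero) (hc.fderiv (𝕜 := ℝ)) hV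

theorem integrable_mul_fderiv_apply {ζ χ : E → ℝ} (hζ : Continuous ζ) (hχ : ContDiff ℝ 1 χ)
    (hc : HasCompactSupport ζ) (hV : LocallyIntegrable V μ) :
    Integrable (fun p => ζ p * fderiv ℝ χ p (V p)) μ :=
  integrable_clm_apply (L := fun p => ζ p • fderiv ℝ χ p)
    (hζ.smul (hχ.continuous_fderiv one_ne_zero)) (hc.smul_right) hV

/-- The weak divergence identity extends along cut-off functions `χ k → 1` whose gradients
contribute nothing in the limit. -/
theorem integral_fderiv_eq_of_cutoff {W : Set E} (h : HasWeakDiv μ V g W)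
    (hV : LocallyIntegrable V μ) (hg : LocallyIntegrable g μ)
    {ζ : E → ℝ} (hζ : ContDiff ℝ 1 ζ) (hc : HasCompactSupport ζ)
    (χ : ℕ → E → ℝ) (hχ : ∀ k, ContDiff ℝ 1 (χ k)) (hχ1 : ∀ k p, |χ k p| ≤ 1)
    (hW : ∀ k, tsupport (fun p => χ k p * ζ p) ⊆ W)
    (hlim : ∀ᵐ p ∂μ, Tendsto (fun k => χ k p) atTop (𝓝 1))
    (hgrad : Tendsto (fun k => ∫ p, ζ p * fderiv ℝ (χ k) p (V p) ∂μ) atTop (𝓝 0)) :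
    ∫ p, fderiv ℝ ζ p (V p) ∂μ = - ∫ p, ζ p * g p ∂μ := by
  have hI1 := integrable_fderiv_apply hζ hc hV
  have hI2 := integrable_mul_of_compact hζ.continuous hc hg
  have hm (k : ℕ) : AEStronglyMeasurable (χ k) μ := (hχ k).continuous.aestronglyMeasurable
  have key (f : E → ℝ) (hf : Integrable f μ) :
      Tendsto (fun k => ∫ p, χ k p * f p ∂μ) atTop (𝓝 (∫ p, f p ∂μ)) := by
    refine tendsto_integral_of_dominated_convergence (fun p => ‖f p‖)
      (fun k => (hm k).mul hf.aestronglyMeasurable) hf.norm ?_ ?_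
    · intro k
      refine Eventually.of_forall fun p => ?_
      rw [norm_mul, Real.norm_eq_abs]
      exact mul_le_of_le_one_left (norm_nonneg _) (hχ1 k p)
    · filter_upwards [hlim] with p hp
      simpa using hp.mul_const (f p)
  -- Test with `χ k * ζ`, which is admissible in `W`; the product rule isolates the gradient of the
  -- cut-off.
  have hId (k : ℕ) : ∫ p, χ k p * fderiv ℝ ζ p (V p) ∂μ
      + ∫ p, ζ p * fderiv ℝ (χ k) p (V p) ∂μ = - ∫ p, χ k p * (ζ p * g p) ∂μ := by
    have h0 := h (fun p => χ k p * ζ p) ((hχ k).mul hζ) hc.mul_left (hW k)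
    simp only [fderiv_mul_apply hζ (hχ k), mul_assoc] at h0
    rw [← h0, integral_add]
    · exact hI1.bdd_mul (hm k) (Eventually.of_forall fun p => hχ1 k p)
    · exact integrable_mul_fderiv_apply hζ.continuous (hχ k) hc hV
  have h1 := (key _ hI1).add hgrad
  simp only [hId, add_zero] at h1
  exact tendsto_nhds_unique h1 (key _ hI2).neg

/-- A two-term partition of unity: `ξ = 1` near the part of the support outside `B`, and `ξ = 0`
outside `D`, whose closure lies in `A`. Then `ξ ζ` is admissible for `A` and `(1 - ξ) ζ` for `B`. -/
theorem HasWeakDiv.union (hV : LocallyIntegrable V μ) (hg : LocallyIntegrable g μ)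
    {A B : Set E} (hA : IsOpen A) (hB : IsOpen B)
    (h1 : HasWeakDiv μ V g A) (h2 : HasWeakDiv μ V g B) : HasWeakDiv μ V g (A ∪ B) := by
  intro ζ hζ hc hs
  have hcl : IsClosed (tsupport ζ \ B) := (isClosed_tsupport ζ).sdiff hB
  have hsub : tsupport ζ \ B ⊆ A := fun p hp => (hs hp.1).resolve_right hp.2
  obtain ⟨D, hDo, hD1, hD2⟩ := normal_exists_closure_subset hcl hA hsub
  obtain ⟨ξ, hξ1, hξ0, -⟩ := exists_contMDiffMap_one_nhds_of_subset_interior (n := 1)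
    (modelWithCornersSelf ℝ E) (s := tsupport ζ \ B) (t := D) hcl
    (by rwa [hDo.interior_eq])
  have hξ : ContDiff ℝ 1 ξ := ξ.contMDiff.contDiff
  have hA' := h1 (fun p => ξ p * ζ p) (hξ.mul hζ) hc.mul_left (by
    refine (closure_mono ?_).trans hD2
    intro p hp
    by_contra hpD
    exact hp (by simp [hξ0 p hpD]))
  have hB' := h2 (fun p => (1 - ξ p) * ζ p) ((contDiff_const.sub hξ).mul hζ) hc.mul_left (by
    intro p hp
    by_contra hpB
    have hp1 : p ∈ tsupport ζ := closure_mono (fun q hq => by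
      contrapose! hq
      simp only [Function.mem_support, not_not] at hq
      simp [hq]) hp
    have h3 : ∀ᶠ q in 𝓝 p, ξ q = 1 :=
      (eventually_nhdsSet_iff_forall.1 hξ1) p ⟨hp1, hpB⟩
    refine (notMem_tsupport_iff_eventuallyEq.2 ?_) hp
    filter_upwards [h3] with q hq
    simp [hq])
  have e : ∀ p, fderiv ℝ ζ p (V p) = fderiv ℝ (fun p => ξ p * ζ p) p (V p)
      + fderiv ℝ (fun p => (1 - ξ p) * ζ p) p (V p) := by
    intro p
    rw [fderiv_mul_apply hζ hξ, fderiv_mul_apply hζ (contDiff_const.sub hξ), fderiv_const_sub]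
    simp only [neg_apply]
    ring
  have e2 : ∀ p, ζ p * g p = (ξ p * ζ p) * g p + ((1 - ξ p) * ζ p) * g p := fun p => by ring
  simp_rw [e, e2]
  rw [integral_add, integral_add, hA', hB', neg_add]
  · exact integrable_mul_of_compact (hξ.mul hζ).continuous hc.mul_left hg
  · exact integrable_mul_of_compact ((contDiff_const.sub hξ).mul hζ).continuous hc.mul_left hg
  · exact integrable_fderiv_apply (hξ.mul hζ) hc.mul_left hV
  · exact integrable_fderiv_apply ((contDiff_const.sub hξ).mul hζ) hc.mul_left hV

/-- Compactness of the support reduces this to finite unions. Locality allows good and bad points to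
be separated pointwise. -/
theorem HasWeakDiv.of_locally (hV : LocallyIntegrable V μ) (hg : LocallyIntegrable g μ)
    {A : Set E} (h : ∀ p ∈ A, ∃ W ∈ 𝓝 p, HasWeakDiv μ V g W) : HasWeakDiv μ V g A := by
  intro ζ hζ hc hs
  obtain ⟨W, -, hsW, hW⟩ : ∃ W : Set E, IsOpen W ∧ tsupport ζ ⊆ W ∧ HasWeakDiv μ V g W := by
    refine IsCompact.induction_on (p := fun K => ∃ W : Set E, IsOpen W ∧ K ⊆ W ∧
      HasWeakDiv μ V g W) hc ?_ ?_ ?_ ?_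
    · refine ⟨∅, isOpen_empty, subset_rfl, fun ζ _ _ hs => ?_⟩
      have : ζ = 0 := tsupport_eq_empty_iff.1 (Set.subset_empty_iff.1 hs)
      simp [this]
    · rintro s t hst ⟨W, hW, htW, h⟩
      exact ⟨W, hW, hst.trans htW, h⟩
    · rintro s t ⟨W, hW, hsW, h⟩ ⟨W', hW', hsW', h'⟩
      exact ⟨W ∪ W', hW.union hW', Set.union_subset_union hsW hsW',
        HasWeakDiv.union hV hg hW hW' h h'⟩
    · intro p hp
      obtain ⟨W, hWp, hW⟩ := h p (hs hp)
      obtain ⟨W', hW's, hW'o, hpW'⟩ := mem_nhds_iff.1 hWp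
      exact ⟨W', mem_nhdsWithin_of_mem_nhds (hW'o.mem_nhds hpW'), W', hW'o, subset_rfl,
        hW.mono hW's⟩
  exact hW ζ hζ hc hsW

/-- Integration by parts for a vector field which is `C¹` near the support of the test function. -/
theorem hasWeakDiv_sum_of_contDiffAt [μ.IsAddHaarMeasure] {ι : Type*} [Fintype ι]
    {f : ι → E → ℝ} {U : Set E} (hf : ∀ i, ∀ p ∈ U, ContDiffAt ℝ 1 (f i) p) (w : ι → E) :
    HasWeakDiv μ (fun p => ∑ i, f i p • w i) (fun p => ∑ i, fderiv ℝ (f i) p (w i)) U := by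
  intro ζ hζ hc hs
  have hcf (i : ι) : ContinuousOn (f i) U := fun p hp =>
    (hf i p hp).continuousAt.continuousWithinAt
  have hcf' (i : ι) : ContinuousOn (fderiv ℝ (f i)) U := fun p hp =>
    ((hf i p hp).continuousAt_fderiv one_ne_zero).continuousWithinAt
  have hcζ' (v : E) : Continuous (fun p => fderiv ℝ ζ p v) :=
    (hζ.continuous_fderiv one_ne_zero).clm_apply continuous_const
  have int (a b : E → ℝ) (ha : ContinuousOn a U) (hb : Continuous b)
      (hbs : Function.support b ⊆ tsupport ζ) : Integrable (fun p => a p * b p) μ := by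
    have : IntegrableOn (fun p => a p * b p) (tsupport ζ) μ :=
      ((ha.mono hs).mul hb.continuousOn).integrableOn_compact hc
    refine (integrableOn_iff_integrable_of_support_subset ?_).1 this
    refine (Function.support_mul_subset_right _ _).trans hbs
  have hs' (v : E) : Function.support (fun p => fderiv ℝ ζ p v) ⊆ tsupport ζ := by
    intro p hp
    refine support_fderiv_subset ℝ (f := ζ) fun h0 => hp ?_
    simp [h0]
  have hI1 (i : ι) := int _ _ (hcf i) (hcζ' (w i)) (hs' (w i))
  have hI2 (i : ι) := int _ _ ((hcf' i).clm_apply (continuousOn_const (c := w i))) hζ.continuous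
    (subset_tsupport ζ)
  have key (i : ι) := integral_mul_fderiv_eq_neg_fderiv_mul_of_integrable (hI2 i) (hI1 i)
    (int _ _ (hcf i) hζ.continuous (subset_tsupport ζ))
    (fun p hp => (hf i p (hs hp)).differentiableAt one_ne_zero)
    (fun p _ => hζ.differentiable one_ne_zero p)
  simp only [map_sum, map_smul, smul_eq_mul, mul_comm (ζ _), Finset.sum_mul]
  rw [integral_finsetSum _ fun i _ => hI1 i, integral_finsetSum _ fun i _ => hI2 i,
    ← Finset.sum_neg_distrib]
  exact Finset.sum_congr rfl fun i _ => key i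

/-- A function which is continuous and locally bounded off a null set is locally integrable. -/
theorem locallyIntegrable_of_bounded_off [IsLocallyFiniteMeasure μ] {F : Type*}
    [NormedAddCommGroup F] {f : E → F} {S : Set E} (hS : μ S = 0)
    (hf : ∀ p, p ∉ S → ContinuousAt f p)
    (hb : ∀ p, ∃ M : ℝ, ∀ᶠ q in 𝓝 p, q ∉ S → ‖f q‖ ≤ M) : LocallyIntegrable f μ := by
  -- `S` need not be measurable, so its measurable hull is used to obtain measurability of `f`.
  have hT : μ (toMeasurable μ S) = 0 := by rwa [measure_toMeasurable]
  have hm : AEStronglyMeasurable f μ := by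
    have h1 : ContinuousOn f (toMeasurable μ S)ᶜ := fun p hp =>
      (hf p fun hpS => hp (subset_toMeasurable μ S hpS)).continuousWithinAt
    have h2 := h1.aestronglyMeasurable (μ := μ) (measurableSet_toMeasurable μ S).compl
    have h3 : μ.restrict (toMeasurable μ S)ᶜ = μ :=
      Measure.restrict_eq_self_of_ae_mem (measure_eq_zero_iff_ae_notMem.1 hT)
    rwa [h3] at h2
  intro p
  obtain ⟨M, hM⟩ := hb p
  have h0 : IntegrableAtFilter f (𝓝 p ⊓ ae μ) μ := by
    refine (μ.finiteAt_nhds p).inf_of_left.integrableAtFilter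
      (hm.stronglyMeasurableAtFilter) ⟨M, ?_⟩
    rw [eventually_map]
    have h1 : ∀ᶠ q in ae μ, q ∉ S := measure_eq_zero_iff_ae_notMem.1 hS
    filter_upwards [h1.filter_mono inf_le_right, hM.filter_mono inf_le_left] with q hq hqM
    exact hqM hq
  exact h0.of_inf_ae

end WeakDiv

/-! ### Removing closed sets of vanishing codimension-one Hausdorff measure -/

section Removable

variable {E : Type*} [NormedAddCommGroup E] [NormedSpace ℝ E] [MeasurableSpace E] [BorelSpace E]

/-- Nullity gives a countable cover with small `∑ diam ^ N`. Each covering set that meets `K` lies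
in an open ball centred in `K` with radius slightly above its diameter, and compactness leaves
finitely many balls. -/
theorem exists_finite_cover_of_hausdorffMeasure_eq_zero {E : Type*} [NormedAddCommGroup E]
    [MeasurableSpace E] [BorelSpace E] {N : ℕ} {K : Set E} (hK : IsCompact K)
    (h0 : μH[(N : ℝ)] K = 0) {ε δ : ℝ} (hε : 0 < ε) (hδ : 0 < δ) :
    ∃ (F : Finset ℕ) (x : ℕ → E) (r : ℕ → ℝ), (∀ n ∈ F, x n ∈ K ∧ 0 < r n ∧ r n < δ) ∧
      K ⊆ ⋃ n ∈ F, Metric.ball (x n) (r n) ∧ ∑ n ∈ F, r n ^ N < ε := by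
  have hε2 : (0 : ENNReal) < ENNReal.ofReal (ε / 2) := by simpa using hε
  have hδ2 : (0 : ENNReal) < ENNReal.ofReal (δ / 2) := by simpa using hδ
  rw [Measure.hausdorffMeasure_apply] at h0
  have h1 := (iSup_eq_bot.1 ((iSup_eq_bot.1 h0) (ENNReal.ofReal (δ / 2)))) hδ2
  have h2 := h1.trans_lt hε2
  simp only [iInf_lt_iff] at h2
  obtain ⟨t, hKt, htd, hts⟩ := h2
  -- `e n` pays for enlarging the diameter to a strictly larger radius; half of `ε` is reserved for
  -- these excesses.
  obtain ⟨e, he0, hes⟩ := ENNReal.exists_pos_sum_of_countable hε2.ne' ℕ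
  have hex (n : ℕ) : ∃ (y : E) (ρ : ℝ), (t n ∩ K).Nonempty →
      y ∈ K ∧ 0 < ρ ∧ ρ < δ ∧ t n ⊆ Metric.ball y ρ ∧
      ENNReal.ofReal (ρ ^ N) ≤ (⨆ _ : (t n).Nonempty, Metric.ediam (t n) ^ (N : ℝ)) + e n := by
    by_cases hne : (t n ∩ K).Nonempty
    · obtain ⟨y, hyt, hyK⟩ := hne
      have hfin : Metric.ediam (t n) ≠ ⊤ := ((htd n).trans_lt ENNReal.ofReal_lt_top).ne
      set D : ℝ := (Metric.ediam (t n)).toReal with hD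
      have hD0 : 0 ≤ D := ENNReal.toReal_nonneg
      have hDe : Metric.ediam (t n) = ENNReal.ofReal D := (ENNReal.ofReal_toReal hfin).symm
      have hDδ : D < δ := by
        have := ENNReal.toReal_mono ENNReal.ofReal_ne_top (htd n)
        rw [ENNReal.toReal_ofReal (by positivity)] at this
        linarith
      have hc : Tendsto (fun ρ : ℝ => ρ ^ N) (𝓝[>] D) (𝓝 (D ^ N)) :=
        ((continuous_pow N).tendsto D).mono_left nhdsWithin_le_nhds
      have hlt : D ^ N < D ^ N + (e n : ℝ) := by
        have := he0 n
        have : (0 : ℝ) < e n := by exact_mod_cast this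
        linarith
      have hδ' : ∀ᶠ ρ in 𝓝[>] D, ρ < δ := nhdsWithin_le_nhds (Iio_mem_nhds hDδ)
      have hD' : ∀ᶠ ρ in 𝓝[>] D, D < ρ := self_mem_nhdsWithin
      obtain ⟨ρ, h1, h2, h3⟩ := ((hc.eventually_lt_const hlt).and (hδ'.and hD')).exists
      refine ⟨y, ρ, fun _ => ⟨hyK, hD0.trans_lt h3, h2, ?_, ?_⟩⟩
      · intro z hz
        have hle := Metric.edist_le_ediam_of_mem hz hyt
        rw [hDe] at hle
        rw [Metric.mem_ball]
        rw [edist_dist] at hle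
        exact ((ENNReal.ofReal_le_ofReal_iff hD0).1 hle).trans_lt h3
      · rw [ciSup_pos ⟨y, hyt⟩, hDe, ENNReal.rpow_natCast, ← ENNReal.ofReal_pow hD0]
        refine (ENNReal.ofReal_le_ofReal h1.le).trans ?_
        rw [ENNReal.ofReal_add (by positivity) (by positivity)]
        simp
    -- Sets missing `K` are discarded below, so their centre and radius are arbitrary.
    · exact ⟨0, 0, fun h => absurd h hne⟩
  choose x r hxr using hex
  obtain ⟨F, hF⟩ := hK.elim_finite_subcover
    (fun n => {z | z ∈ Metric.ball (x n) (r n) ∧ (t n ∩ K).Nonempty})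
    (fun n => by
      by_cases h : (t n ∩ K).Nonempty
      · simp only [h, and_true]
        exact Metric.isOpen_ball
      · simp [h])
    (fun z hz => by
      obtain ⟨n, hn⟩ := Set.mem_iUnion.1 (hKt hz)
      have hne : (t n ∩ K).Nonempty := ⟨z, hn, hz⟩
      exact Set.mem_iUnion.2 ⟨n, (hxr n hne).2.2.2.1 hn, hne⟩)
  classical
  refine ⟨F.filter fun n => (t n ∩ K).Nonempty, x, r, ?_, ?_, ?_⟩
  · intro n hn
    have h := hxr n (Finset.mem_filter.1 hn).2
    exact ⟨h.1, h.2.1, h.2.2.1⟩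
  · intro z hz
    have := hF hz
    simp only [Set.mem_iUnion, exists_prop] at this ⊢
    obtain ⟨n, hn, hz1, hz2⟩ := this
    exact ⟨n, Finset.mem_filter.2 ⟨hn, hz2⟩, hz1⟩
  · have hnn : ∀ n ∈ F.filter fun n => (t n ∩ K).Nonempty, 0 ≤ r n ^ N := fun n hn =>
      pow_nonneg (hxr n (Finset.mem_filter.1 hn).2).2.1.le _
    rw [← ENNReal.ofReal_lt_ofReal_iff hε, ENNReal.ofReal_sum_of_nonneg hnn]
    calc ∑ n ∈ F.filter fun n => (t n ∩ K).Nonempty, ENNReal.ofReal (r n ^ N)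
        ≤ ∑ n ∈ F.filter fun n => (t n ∩ K).Nonempty,
          ((⨆ _ : (t n).Nonempty, Metric.ediam (t n) ^ (N : ℝ)) + e n) :=
          Finset.sum_le_sum fun n hn => (hxr n (Finset.mem_filter.1 hn).2).2.2.2.2
      _ ≤ ∑' n, ((⨆ _ : (t n).Nonempty, Metric.ediam (t n) ^ (N : ℝ)) + e n) :=
          ENNReal.sum_le_tsum _
      _ = (∑' n, ⨆ _ : (t n).Nonempty, Metric.ediam (t n) ^ (N : ℝ)) + ∑' n, (e n : ENNReal) :=
          ENNReal.tsum_add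
      _ < ENNReal.ofReal (ε / 2) + ENNReal.ofReal (ε / 2) := ENNReal.add_lt_add hts hes
      _ = ENNReal.ofReal ε := by
          rw [← ENNReal.ofReal_add (by positivity) (by positivity), add_halves]

theorem exists_bound_deriv_smoothTransition :
    ∃ C : ℝ, 0 ≤ C ∧ ∀ s, |deriv Real.smoothTransition s| ≤ C := by
  have hc : Continuous (deriv Real.smoothTransition) :=
    (Real.smoothTransition.contDiff (n := 1)).continuous_deriv le_rfl
  obtain ⟨C, hC⟩ := isCompact_Icc.exists_bound_of_continuousOn (s := Set.Icc (0 : ℝ) 1)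
    hc.continuousOn
  refine ⟨C, (norm_nonneg _).trans (hC 0 (by simp)), fun s => ?_⟩
  by_cases h0 : s < 0
  · have : Real.smoothTransition =ᶠ[𝓝 s] fun _ => 0 := by
      filter_upwards [Iio_mem_nhds h0] with y hy
      exact Real.smoothTransition.zero_of_nonpos (le_of_lt hy)
    rw [this.deriv_eq]
    simpa using (norm_nonneg _).trans (hC 0 (by simp))
  by_cases h1 : 1 < s
  · have : Real.smoothTransition =ᶠ[𝓝 s] fun _ => 1 := by
      filter_upwards [Ioi_mem_nhds h1] with y hy
      exact Real.smoothTransition.one_of_one_le (le_of_lt hy)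
    rw [this.deriv_eq]
    simpa using (norm_nonneg _).trans (hC 0 (by simp))
  · exact hC s ⟨not_lt.1 h0, not_lt.1 h1⟩

variable [FiniteDimensional ℝ E]

/-- Sum the bumps rescaled to the balls and compose with `1 - smoothTransition`: the sum is at least
`1` on the balls and `0` off the doubled balls. In dimension `N + 1` the gradient of a bump of
radius `r` has `L¹` norm proportional to `r⁻¹ * r ^ (N + 1) = r ^ N`. -/
theorem exists_cutoff_of_balls (μ : Measure E) [μ.IsAddHaarMeasure] {N : ℕ}
    (hN : Module.finrank ℝ E = N + 1) :
    ∃ C : ℝ, 0 ≤ C ∧ ∀ (F : Finset ℕ) (x : ℕ → E) (r : ℕ → ℝ), (∀ n ∈ F, 0 < r n) →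
      ∃ χ : E → ℝ, ContDiff ℝ 1 χ ∧ (∀ p, |χ p| ≤ 1) ∧
        (∀ p ∈ ⋃ n ∈ F, Metric.ball (x n) (r n), χ p = 0) ∧
        (∀ p, (∀ n ∈ F, 2 * r n ≤ dist p (x n)) → χ p = 1) ∧
        Integrable (fun p => ‖fderiv ℝ χ p‖) μ ∧
        ∫ p, ‖fderiv ℝ χ p‖ ∂μ ≤ C * ∑ n ∈ F, r n ^ N := by
  obtain ⟨C₀, hC₀, hST⟩ := exists_bound_deriv_smoothTransition
  let b : ContDiffBump (0 : E) := ⟨1, 2, one_pos, one_lt_two⟩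
  have hb : ContDiff ℝ 1 b := b.contDiff
  have hbI : Integrable (fun p => ‖fderiv ℝ b p‖) μ :=
    (hb.continuous_fderiv one_ne_zero).norm.integrable_of_hasCompactSupport
      (b.hasCompactSupport.fderiv (𝕜 := ℝ)).norm
  refine ⟨C₀ * ∫ p, ‖fderiv ℝ b p‖ ∂μ,
    mul_nonneg hC₀ (integral_nonneg fun _ => norm_nonneg _), fun F x r hr => ?_⟩
  let η : ℕ → E → ℝ := fun n p => b ((r n)⁻¹ • (p - x n))
  have hη (n : ℕ) : ContDiff ℝ 1 (η n) :=
    hb.comp (contDiff_const.smul (contDiff_id.sub contDiff_const))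
  have hη' (n : ℕ) (p : E) :
      fderiv ℝ (η n) p = (r n)⁻¹ • fderiv ℝ b ((r n)⁻¹ • (p - x n)) := by
    have h1 : HasFDerivAt (fun p : E => (r n)⁻¹ • (p - x n))
        ((r n)⁻¹ • ContinuousLinearMap.id ℝ E) p :=
      ((hasFDerivAt_id p).sub_const (x n)).const_smul _
    have h2 := ((hb.differentiable one_ne_zero) ((r n)⁻¹ • (p - x n))).hasFDerivAt.comp p h1
    rw [show η n = b ∘ fun p : E => (r n)⁻¹ • (p - x n) from rfl, h2.fderiv]
    ext v
    simp
  let s : E → ℝ := fun p => ∑ n ∈ F, η n p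
  have hs : ContDiff ℝ 1 s := ContDiff.sum fun n _ => hη n
  have hs' (p : E) : fderiv ℝ s p = ∑ n ∈ F, fderiv ℝ (η n) p :=
    fderiv_fun_sum fun n _ => (hη n).differentiable one_ne_zero p
  have hχ : ContDiff ℝ 1 fun p => 1 - Real.smoothTransition (s p) :=
    contDiff_const.sub (Real.smoothTransition.contDiff.comp hs)
  have hηI (n : ℕ) (hn : n ∈ F) : Integrable (fun p => ‖fderiv ℝ (η n) p‖) μ := by
    simp only [hη', norm_smul]
    exact ((hbI.comp_smul (inv_ne_zero (hr n hn).ne')).comp_sub_right (x n)).const_mul _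
  have hηi (n : ℕ) (hn : n ∈ F) :
      ∫ p, ‖fderiv ℝ (η n) p‖ ∂μ = r n ^ N * ∫ p, ‖fderiv ℝ b p‖ ∂μ := by
    simp only [hη', norm_smul]
    rw [integral_const_mul,
      integral_sub_right_eq_self (fun p => ‖fderiv ℝ b ((r n)⁻¹ • p)‖) (x n),
      Measure.integral_comp_inv_smul μ (fun p => ‖fderiv ℝ b p‖) (r n), hN]
    have hrn := hr n hn
    rw [Real.norm_eq_abs, abs_of_pos (inv_pos.2 hrn), abs_of_pos (pow_pos hrn _), smul_eq_mul,
      pow_succ]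
    field_simp
  have hle (p : E) : ‖fderiv ℝ (fun p => 1 - Real.smoothTransition (s p)) p‖
      ≤ C₀ * ∑ n ∈ F, ‖fderiv ℝ (η n) p‖ := by
    have h1 : HasFDerivAt (fun p => Real.smoothTransition (s p))
        (deriv Real.smoothTransition (s p) • fderiv ℝ s p) p :=
      (((Real.smoothTransition.contDiff (n := 1)).differentiable one_ne_zero)
        (s p)).hasDerivAt.comp_hasFDerivAt p (hs.differentiable one_ne_zero p).hasFDerivAt
    rw [fderiv_const_sub, h1.fderiv, norm_neg, norm_smul, hs']
    exact mul_le_mul (hST _) (norm_sum_le _ _) (norm_nonneg _) hC₀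
  have hI2 : Integrable (fun p => C₀ * ∑ n ∈ F, ‖fderiv ℝ (η n) p‖) μ :=
    (integrable_finsetSum F fun n hn => hηI n hn).const_mul _
  have hI : Integrable (fun p => ‖fderiv ℝ (fun p => 1 - Real.smoothTransition (s p)) p‖) μ := by
    refine hI2.mono' (hχ.continuous_fderiv one_ne_zero).norm.aestronglyMeasurable
      (Eventually.of_forall fun p => ?_)
    rw [norm_norm]
    exact hle p
  refine ⟨fun p => 1 - Real.smoothTransition (s p), hχ, fun p => ?_, fun p hp => ?_,
    fun p hp => ?_, hI, ?_⟩
  · have h1 := Real.smoothTransition.nonneg (s p)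
    have h2 := Real.smoothTransition.le_one (s p)
    rw [abs_le]
    constructor <;> linarith
  · simp only [Set.mem_iUnion, exists_prop] at hp
    obtain ⟨n, hn, hpn⟩ := hp
    have h1 : η n p = 1 := by
      refine b.one_of_mem_closedBall ?_
      rw [mem_closedBall_zero_iff, norm_smul, norm_inv, Real.norm_eq_abs, abs_of_pos (hr n hn),
        ← dist_eq_norm, inv_mul_le_iff₀ (hr n hn)]
      simpa [b] using (Metric.mem_ball.1 hpn).le
    have h2 : 1 ≤ s p := h1 ▸
      Finset.single_le_sum (f := fun n => η n p) (fun m _ => b.nonneg) hn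
    simp [Real.smoothTransition.one_of_one_le h2]
  · have : s p = 0 := Finset.sum_eq_zero fun n hn => by
      refine b.zero_of_le_dist ?_
      rw [dist_zero_right, norm_smul, norm_inv, Real.norm_eq_abs, abs_of_pos (hr n hn),
        ← dist_eq_norm, le_inv_mul_iff₀ (hr n hn), mul_comm]
      exact hp n hn
    simp [this]
  · calc _ ≤ ∫ p, C₀ * ∑ n ∈ F, ‖fderiv ℝ (η n) p‖ ∂μ := integral_mono hI hI2 hle
      _ = C₀ * ∑ n ∈ F, r n ^ N * ∫ p, ‖fderiv ℝ b p‖ ∂μ := by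
        rw [integral_const_mul, integral_finsetSum _ hηI, Finset.sum_congr rfl hηi]
      _ = _ := by
        rw [← Finset.sum_mul]
        ring

theorem exists_cutoffs_of_hausdorffMeasure_eq_zero (μ : Measure E) [μ.IsAddHaarMeasure] {N : ℕ}
    (hN : Module.finrank ℝ E = N + 1) {K : Set E} (hK : IsCompact K) (h0 : μH[(N : ℝ)] K = 0) :
    ∃ χ : ℕ → E → ℝ, (∀ k, ContDiff ℝ 1 (χ k)) ∧ (∀ k p, |χ k p| ≤ 1) ∧
      (∀ k, ∀ p ∈ K, χ k =ᶠ[𝓝 p] 0) ∧ (∀ p ∉ K, Tendsto (fun k => χ k p) atTop (𝓝 1)) ∧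
      (∀ k, Integrable (fun p => ‖fderiv ℝ (χ k) p‖) μ) ∧
      Tendsto (fun k => ∫ p, ‖fderiv ℝ (χ k) p‖ ∂μ) atTop (𝓝 0) := by
  obtain ⟨C, hC, hcut⟩ := exists_cutoff_of_balls μ hN
  have hpos (k : ℕ) : (0 : ℝ) < 1 / ((k : ℝ) + 1) := Nat.one_div_pos_of_nat
  choose F x r hF hKF hsum using fun k : ℕ =>
    exists_finite_cover_of_hausdorffMeasure_eq_zero hK h0 (hpos k) (hpos k)
  choose χ h1 h2 h3 h4 h5 h6 using fun k : ℕ => hcut (F k) (x k) (r k) fun n hn => (hF k n hn).2.1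
  have hlim : Tendsto (fun k : ℕ => 1 / ((k : ℝ) + 1)) atTop (𝓝 0) :=
    tendsto_one_div_add_atTop_nhds_zero_nat
  refine ⟨χ, h1, h2, fun k p hp => ?_, fun p hp => ?_, h5, ?_⟩
  · have ho : IsOpen (⋃ n ∈ F k, Metric.ball (x k n) (r k n)) :=
      isOpen_biUnion fun _ _ => Metric.isOpen_ball
    filter_upwards [ho.mem_nhds (hKF k hp)] with q hq using h3 k q hq
  · obtain ⟨ρ, hρ, hball⟩ := Metric.mem_nhds_iff.1 (hK.isClosed.isOpen_compl.mem_nhds hp)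
    refine tendsto_const_nhds.congr' ?_
    -- The balls are centred in `K` with radii below `1 / (k + 1)`, so a point at distance at least
    -- `ρ` from `K` escapes all doubled balls once `1 / (k + 1) < ρ / 2`.
    filter_upwards [hlim.eventually_lt_const (half_pos hρ)] with k hk
    refine (h4 k p fun n hn => ?_).symm
    by_contra! hlt
    have h := hF k n hn
    refine hball (a := x k n) ?_ h.1
    rw [Metric.mem_ball, dist_comm]
    linarith
  · refine squeeze_zero (fun k => integral_nonneg fun _ => norm_nonneg _) (fun k => (h6 k).trans
      (mul_le_mul_of_nonneg_left (hsum k).le hC)) ?_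
    simpa using hlim.const_mul C

/-- A locally bounded field whose weak divergence is known off a closed set of vanishing
codimension-one Hausdorff measure has no singular divergence on this set. -/
theorem HasWeakDiv.of_compl {μ : Measure E} [μ.IsAddHaarMeasure] {N : ℕ}
    (hN : Module.finrank ℝ E = N + 1) {V : E → E} {g : E → ℝ} (hV : LocallyIntegrable V μ)
    (hg : LocallyIntegrable g μ) (hVb : ∀ p, ∃ M : ℝ, ∃ W ∈ 𝓝 p, ∀ᵐ q ∂μ, q ∈ W → ‖V q‖ ≤ M)
    {Z : Set E} (hZ : IsClosed Z) (h0 : μH[(N : ℝ)] Z = 0) (hZμ : μ Z = 0)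
    (h : HasWeakDiv μ V g Zᶜ) : HasWeakDiv μ V g Set.univ := by
  intro ζ hζ hc _
  -- Only the compact part of `Z` inside the support has to be cut out.
  have hK : IsCompact (tsupport ζ ∩ Z) := hc.isCompact.inter_right hZ
  obtain ⟨χ, h1, h2, h3, h4, h5, h6⟩ := exists_cutoffs_of_hausdorffMeasure_eq_zero μ hN hK
    (measure_mono_null Set.inter_subset_right h0)
  obtain ⟨M, hM0, hM⟩ : ∃ M : ℝ, 0 ≤ M ∧ ∀ᵐ q ∂μ, q ∈ tsupport ζ → ‖V q‖ ≤ M := by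
    refine hc.isCompact.induction_on
      (p := fun K => ∃ M : ℝ, 0 ≤ M ∧ ∀ᵐ q ∂μ, q ∈ K → ‖V q‖ ≤ M)
      ⟨0, le_rfl, by simp⟩ ?_ ?_ ?_
    · rintro s t hst ⟨M, hM0, hM⟩
      exact ⟨M, hM0, hM.mono fun q hq hqs => hq (hst hqs)⟩
    · rintro s t ⟨M, hM0, hM⟩ ⟨M', -, hM'⟩
      refine ⟨max M M', le_max_of_le_left hM0, ?_⟩
      filter_upwards [hM, hM'] with q h1 h2 hq
      exact hq.elim (fun hq => le_max_of_le_left (h1 hq)) fun hq => le_max_of_le_right (h2 hq)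
    · intro p _
      obtain ⟨M, W, hW, hM⟩ := hVb p
      exact ⟨W, mem_nhdsWithin_of_mem_nhds hW, max M 0, le_max_right _ _,
        hM.mono fun q hq hqW => le_max_of_le_left (hq hqW)⟩
  obtain ⟨B, hB⟩ := hζ.continuous.bounded_above_of_compact_support hc
  have hB0 : 0 ≤ B := (norm_nonneg _).trans (hB 0)
  refine integral_fderiv_eq_of_cutoff h hV hg hζ hc χ h1 h2 (fun k p hp hpZ => ?_) ?_ ?_
  · have hpζ : p ∈ tsupport ζ := closure_mono (fun q hq => by
      contrapose! hq
      simp only [Function.mem_support, not_not] at hq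
      simp [hq]) hp
    refine (notMem_tsupport_iff_eventuallyEq.2 ?_) hp
    filter_upwards [h3 k p ⟨hpζ, hpZ⟩] with q hq
    simp [hq]
  · have : ∀ᵐ p ∂μ, p ∉ Z := measure_eq_zero_iff_ae_notMem.1 hZμ
    filter_upwards [this] with p hp using h4 p fun hp' => hp hp'.2
  -- The gradient term is at most `sup |ζ| * sup ‖V‖` on the support times `∫ ‖∇χ k‖`, which tends
  -- to `0`.
  · refine squeeze_zero_norm (a := fun k => (B * M) * ∫ p, ‖fderiv ℝ (χ k) p‖ ∂μ) (fun k => ?_)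
      (by simpa using h6.const_mul (B * M))
    rw [← integral_const_mul]
    refine norm_integral_le_of_norm_le ((h5 k).const_mul _) ?_
    filter_upwards [hM] with p hp
    by_cases hps : p ∈ tsupport ζ
    · rw [norm_mul]
      calc ‖ζ p‖ * ‖fderiv ℝ (χ k) p (V p)‖ ≤ B * (‖fderiv ℝ (χ k) p‖ * M) := by
            refine mul_le_mul (hB p) (((fderiv ℝ (χ k) p).le_opNorm _).trans ?_)
              (norm_nonneg _) hB0
            exact mul_le_mul_of_nonneg_left (hp hps) (norm_nonneg _)
        _ = _ := by ring
    · rw [image_eq_zero_of_notMem_tsupport hps]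
      simp only [zero_mul, norm_zero]
      positivity

end Removable

/-! ### Removing a `C¹` graph -/

section RescaledKernel

variable {m : ℝ → ℝ} {a : ℝ}

theorem integral_rescale (m : ℝ → ℝ) (a : ℝ) (k : ℕ) :
    ∫ t, m ((k + 1) * (t - a)) * (k + 1) = ∫ t, m t := by
  have hk : (0 : ℝ) < (k : ℝ) + 1 := by positivity
  rw [integral_mul_const, integral_sub_right_eq_self (fun t => m ((k + 1) * t)) a,
    Measure.integral_comp_mul_left m, abs_of_pos (inv_pos.2 hk), smul_eq_mul]
  field_simp

theorem integrable_rescale (hm : Integrable m) (a : ℝ) (k : ℕ) :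
    Integrable fun t => m ((k + 1) * (t - a)) * (k + 1) := by
  have hk : (k : ℝ) + 1 ≠ 0 := by positivity
  exact ((hm.comp_mul_left' hk).comp_sub_right a).mul_const _

theorem norm_integral_mul_rescale_le (hm : Integrable m) {f : ℝ → ℝ} {C : ℝ} (k : ℕ)
    (hf : ∀ t, t ≠ a → m ((k + 1) * (t - a)) ≠ 0 → |f t| ≤ C) :
    ‖∫ t, f t * (m ((k + 1) * (t - a)) * (k + 1))‖ ≤ C * ∫ t, |m t| := by
  rw [← integral_rescale (fun t => |m t|) a k, ← integral_const_mul]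
  refine norm_integral_le_of_norm_le ((integrable_rescale hm.abs a k).const_mul C) ?_
  filter_upwards [(show ∀ᵐ t : ℝ, t ≠ a by simp [ae_iff])] with t ht
  have hk : (0 : ℝ) < (k : ℝ) + 1 := by positivity
  rw [norm_mul, norm_mul, Real.norm_eq_abs, Real.norm_eq_abs, Real.norm_eq_abs, abs_of_pos hk]
  by_cases h0 : m ((k + 1) * (t - a)) = 0
  · simp [h0]
  · exact mul_le_mul_of_nonneg_right (hf t ht h0) (by positivity)

/-- The kernel has mean zero, so `f` may be replaced by `f - L`, which is small on the shrinking
support `|t - a| < 1 / (k + 1)`. The value of `f` at `a` plays no role: continuity across the front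
is needed only in the sense of a common limit. -/
theorem tendsto_integral_mul_rescale (hm : Integrable m) (hm0 : ∫ t, m t = 0)
    (hms : ∀ t, 1 ≤ |t| → m t = 0) {f : ℝ → ℝ} {L : ℝ} (hf : Tendsto f (𝓝[≠] a) (𝓝 L)) :
    Tendsto (fun k : ℕ => ∫ t, f t * (m ((k + 1) * (t - a)) * (k + 1))) atTop (𝓝 0) := by
  have hsub (k : ℕ) : ∫ t, f t * (m ((k + 1) * (t - a)) * (k + 1))
      = ∫ t, (f t - L) * (m ((k + 1) * (t - a)) * (k + 1)) := by
    have hL := (integrable_rescale hm a k).const_mul L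
    -- Without integrability the shifted integrand is not integrable either, and both integrals have
    -- the default value `0`.
    by_cases hI : Integrable fun t => f t * (m ((k + 1) * (t - a)) * (k + 1))
    · simp_rw [sub_mul]
      rw [integral_sub hI hL, integral_const_mul, integral_rescale, hm0]
      simp
    · rw [integral_undef hI, integral_undef]
      intro h
      refine hI ((h.add hL).congr (Eventually.of_forall fun t => ?_))
      simp only [Pi.add_apply]
      ring
  simp_rw [hsub]
  have hA : 0 ≤ ∫ t, |m t| := integral_nonneg fun _ => abs_nonneg _
  rw [Metric.tendsto_atTop]
  intro ε hε
  set A := ∫ t, |m t|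
  have hε' : 0 < ε / (A + 1) := by positivity
  have h1 := (Metric.tendsto_nhdsWithin_nhds.1 hf) _ hε'
  obtain ⟨δ, hδ, h1⟩ := h1
  obtain ⟨k₀, hk₀⟩ := exists_nat_one_div_lt hδ
  refine ⟨k₀, fun k hk => ?_⟩
  rw [dist_zero_right]
  refine (norm_integral_mul_rescale_le hm (C := ε / (A + 1)) k fun t ht h0 => ?_).trans_lt ?_
  · rw [← Real.dist_eq]
    refine (h1 ht ?_).le
    have h2 : |((k : ℝ) + 1) * (t - a)| < 1 := by
      by_contra! h
      exact h0 (hms _ h)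
    have hk1 : (0 : ℝ) < (k : ℝ) + 1 := by positivity
    rw [abs_mul, abs_of_pos hk1, ← lt_div_iff₀' hk1] at h2
    rw [Real.dist_eq]
    refine h2.trans (lt_of_le_of_lt ?_ hk₀)
    have : (k₀ : ℝ) ≤ k := by exact_mod_cast hk
    gcongr
  · rw [div_mul_eq_mul_div, div_lt_iff₀ (by positivity)]
    nlinarith

end RescaledKernel

section Graph

theorem measure_graph_eq_zero {X : Type*} [NormedAddCommGroup X] [MeasurableSpace X]
    [BorelSpace X] [SecondCountableTopology X] {ψ : X → ℝ} (ν : Measure X) (hψ : Continuous ψ) :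
    (ν.prod (volume : Measure ℝ)) {p | p.2 = ψ p.1} = 0 := by
  have hc : IsClosed {p : X × ℝ | p.2 = ψ p.1} :=
    isClosed_eq continuous_snd (hψ.comp continuous_fst)
  rw [Measure.measure_prod_null hc.measurableSet]
  refine Eventually.of_forall fun x => ?_
  have : Prod.mk x ⁻¹' {p : X × ℝ | p.2 = ψ p.1} = {ψ x} := by
    ext t
    simp
  simp [this]

variable {X : Type*} [NormedAddCommGroup X] [NormedSpace ℝ X] [FiniteDimensional ℝ X]
  [MeasurableSpace X] [BorelSpace X] {ν : Measure X} {ψ : X → ℝ}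

/-- If the normal component of a bounded field is continuous across almost every point of a `C¹`
graph, then its divergence has no layer on the graph. -/
theorem HasWeakDiv.of_diff_graph [ν.IsAddHaarMeasure] (hψ : ContDiff ℝ 1 ψ)
    {V : X × ℝ → X × ℝ} {g : X × ℝ → ℝ} {W : Set (X × ℝ)}
    (hV : LocallyIntegrable V (ν.prod volume)) (hg : LocallyIntegrable g (ν.prod volume))
    {M : ℝ} (hVb : ∀ q ∈ W, q.2 ≠ ψ q.1 → ‖V q‖ ≤ M)
    (hside : ∀ᵐ x ∂ν, (x, ψ x) ∈ W → ∃ β : ℝ, Tendsto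
      (fun s => (V (x, s)).2 - fderiv ℝ ψ x (V (x, s)).1) (𝓝[≠] ψ x) (𝓝 β))
    (h : HasWeakDiv (ν.prod volume) V g (W \ {p | p.2 = ψ p.1})) :
    HasWeakDiv (ν.prod volume) V g W := by
  intro ζ hζ hc hs
  let η : ContDiffBump (0 : ℝ) := ⟨1 / 2, 1, by norm_num, by norm_num⟩
  have hη : ContDiff ℝ 1 η := η.contDiff
  have hηc : Continuous (deriv η) := hη.continuous_deriv le_rfl
  have hηs : HasCompactSupport (deriv η) := η.hasCompactSupport.deriv
  have hηI : Integrable (deriv η) := hηc.integrable_of_hasCompactSupport hηs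
  have hη0 : ∫ t, deriv η t = 0 :=
    integral_eq_zero_of_hasDerivAt_of_integrable
      (fun t => ((hη.differentiable one_ne_zero) t).hasDerivAt) hηI
      (hη.continuous.integrable_of_hasCompactSupport η.hasCompactSupport)
  have hη1 (t : ℝ) (ht : 1 ≤ |t|) : deriv η t = 0 := by
    -- Where the nonnegative `η` vanishes it has a minimum; this covers the boundary points `|t| =
    -- 1` as well.
    have h1 : IsLocalMin η t := by
      refine Eventually.of_forall fun s => ?_
      rw [η.zero_of_le_dist (by simpa [η] using ht)]
      exact η.nonneg
    exact h1.deriv_eq_zero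
  let σ : ℕ → X × ℝ → ℝ := fun k p => ((k : ℝ) + 1) * (p.2 - ψ p.1)
  have hσ (k : ℕ) : ContDiff ℝ 1 (σ k) :=
    contDiff_const.mul (contDiff_snd.sub (hψ.comp contDiff_fst))
  let χ : ℕ → X × ℝ → ℝ := fun k p => 1 - η (σ k p)
  have hχ (k : ℕ) : ContDiff ℝ 1 (χ k) := contDiff_const.sub (hη.comp (hσ k))
  -- The gradient of the cut-off sees only the component of the field normal to the graph,
  -- multiplied by a rescaled kernel `deriv η` of mean zero.
  have hχ' (k : ℕ) (p v : X × ℝ) : fderiv ℝ (χ k) p v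
      = - ((v.2 - fderiv ℝ ψ p.1 v.1) * (deriv η (σ k p) * (k + 1))) := by
    have e1 : HasFDerivAt (fun q : X × ℝ => ψ q.1)
        ((fderiv ℝ ψ p.1).comp (ContinuousLinearMap.fst ℝ X ℝ)) p :=
      ((hψ.differentiable one_ne_zero) p.1).hasFDerivAt.comp p hasFDerivAt_fst
    have e2 := (((hasFDerivAt_snd (𝕜 := ℝ) (p := p)).sub e1).const_mul ((k : ℝ) + 1))
    have e3 := (((hη.differentiable one_ne_zero) (σ k p)).hasDerivAt.comp_hasFDerivAt p e2).const_sub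
      1
    rw [show fderiv ℝ (χ k) p = _ from e3.fderiv]
    simp
    ring
  have hgraph : ∀ᵐ p ∂(ν.prod (volume : Measure ℝ)), p.2 ≠ ψ p.1 :=
    measure_eq_zero_iff_ae_notMem.1 (measure_graph_eq_zero ν hψ.continuous)
  refine integral_fderiv_eq_of_cutoff h hV hg hζ hc χ hχ ?_ ?_ ?_ ?_
  · intro k p
    have h1 : 0 ≤ η (σ k p) := η.nonneg
    have h2 : η (σ k p) ≤ 1 := η.le_one
    rw [abs_le]
    constructor <;> simp only [χ] <;> linarith
  · intro k p hp
    refine ⟨hs (closure_mono (fun q hq => ?_) hp), fun hpg => ?_⟩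
    · contrapose! hq
      simp only [Function.mem_support, not_not] at hq
      simp [hq]
    · refine (notMem_tsupport_iff_eventuallyEq.2 ?_) hp
      have h0 : σ k p = 0 := by simp [σ, show p.2 = ψ p.1 from hpg]
      have h1 : ∀ᶠ q in 𝓝 p, σ k q ∈ Metric.ball (0 : ℝ) (1 / 2) := by
        refine (hσ k).continuous.continuousAt.eventually_mem ?_
        rw [h0]
        exact Metric.ball_mem_nhds _ (by norm_num)
      filter_upwards [h1] with q hq
      have : η (σ k q) = 1 := η.one_of_mem_closedBall (Metric.ball_subset_closedBall hq)
      simp [χ, this]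
  · filter_upwards [hgraph] with p hp
    have hpos : 0 < |p.2 - ψ p.1| := abs_pos.2 (sub_ne_zero.2 hp)
    obtain ⟨k₀, hk₀⟩ := exists_nat_gt (|p.2 - ψ p.1|)⁻¹
    refine tendsto_const_nhds.congr' ?_
    filter_upwards [eventually_ge_atTop k₀] with k hk
    have : η (σ k p) = 0 := by
      refine η.zero_of_le_dist ?_
      have hk1 : (0 : ℝ) < (k : ℝ) + 1 := by positivity
      rw [dist_zero_right, Real.norm_eq_abs, abs_mul, abs_of_pos hk1]
      have hk2 : (k₀ : ℝ) ≤ k := by exact_mod_cast hk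
      have : (|p.2 - ψ p.1|)⁻¹ * |p.2 - ψ p.1| ≤ ((k : ℝ) + 1) * |p.2 - ψ p.1| :=
        mul_le_mul_of_nonneg_right (by linarith) hpos.le
      rwa [inv_mul_cancel₀ hpos.ne'] at this
    simp [χ, this]
  · obtain ⟨B, hB⟩ := hζ.continuous.bounded_above_of_compact_support hc
    have hB0 : 0 ≤ B := (norm_nonneg _).trans (hB 0)
    have hK : IsCompact (Prod.fst '' tsupport ζ) := hc.isCompact.image continuous_fst
    obtain ⟨D, hD⟩ := hK.exists_bound_of_continuousOn
      (hψ.continuous_fderiv one_ne_zero).continuousOn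
    let A := ∫ t, |deriv η t|
    have hA : 0 ≤ A := integral_nonneg fun _ => abs_nonneg _
    let f : X → ℝ → ℝ := fun x t => -(ζ (x, t) * ((V (x, t)).2 - fderiv ℝ ψ x (V (x, t)).1))
    have hfb (x : X) (hx : x ∈ Prod.fst '' tsupport ζ) (t : ℝ) (ht : t ≠ ψ x) :
        |f x t| ≤ B * (|M| + |D| * |M|) := by
      by_cases hxt : (x, t) ∈ tsupport ζ
      · have hVM : ‖V (x, t)‖ ≤ |M| := (hVb _ (hs hxt) ht).trans (le_abs_self M)
        have h1 : ‖(V (x, t)).1‖ ≤ |M| := (norm_fst_le _).trans hVM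
        have h2 : |(V (x, t)).2| ≤ |M| := (norm_snd_le (V (x, t))).trans hVM
        have h3 : |fderiv ℝ ψ x (V (x, t)).1| ≤ |D| * |M| :=
          ((fderiv ℝ ψ x).le_opNorm _).trans
            (mul_le_mul ((hD x hx).trans (le_abs_self D)) h1 (norm_nonneg _) (abs_nonneg _))
        simp only [f]
        rw [abs_neg, abs_mul]
        exact mul_le_mul (hB _) ((abs_sub _ _).trans (add_le_add h2 h3)) (abs_nonneg _) hB0
      · simp only [f, image_eq_zero_of_notMem_tsupport hxt, zero_mul, neg_zero, abs_zero]
        positivity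
    have hf0 (x : X) (hx : x ∉ Prod.fst '' tsupport ζ) (t : ℝ) : f x t = 0 := by
      have : (x, t) ∉ tsupport ζ := fun h => hx ⟨_, h, rfl⟩
      simp [f, image_eq_zero_of_notMem_tsupport this]
    have hform (k : ℕ) (p : X × ℝ) : ζ p * fderiv ℝ (χ k) p (V p)
        = f p.1 p.2 * (deriv η ((k + 1) * (p.2 - ψ p.1)) * (k + 1)) := by
      rw [hχ']
      simp only [f, σ]
      ring
    have hI (k : ℕ) : Integrable (fun p : X × ℝ =>
        f p.1 p.2 * (deriv η ((k + 1) * (p.2 - ψ p.1)) * (k + 1))) (ν.prod volume) := by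
      simp only [← hform]
      exact integrable_mul_fderiv_apply hζ.continuous (hχ k) hc hV
    -- Fubini reduces the gradient term to vertical lines. There the rescaled mean-zero kernel gives
    -- limit `0`, with a bound that is uniform over the compact projection of the support.
    have hprod (k : ℕ) : ∫ p, ζ p * fderiv ℝ (χ k) p (V p) ∂(ν.prod volume)
        = ∫ x, (∫ t, f x t * (deriv η ((k + 1) * (t - ψ x)) * (k + 1))) ∂ν := by
      simp only [hform]
      exact integral_prod _ (hI k)
    simp only [hprod]
    suffices hT : Tendsto (fun k : ℕ => ∫ x,
        (∫ t, f x t * (deriv η ((k + 1) * (t - ψ x)) * (k + 1))) ∂ν) atTop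
        (𝓝 (∫ _ : X, (0 : ℝ) ∂ν)) by
      rwa [integral_zero] at hT
    refine tendsto_integral_of_dominated_convergence
      ((Prod.fst '' tsupport ζ).indicator fun _ => B * (|M| + |D| * |M|) * A)
      (fun k => (hI k).integral_prod_left.aestronglyMeasurable) ?_ ?_ ?_
    · rw [integrable_indicator_iff hK.measurableSet]
      exact integrableOn_const hK.measure_lt_top.ne
    · refine fun k => Eventually.of_forall fun x => ?_
      by_cases hx : x ∈ Prod.fst '' tsupport ζ
      · rw [Set.indicator_of_mem hx]
        exact norm_integral_mul_rescale_le hηI k fun t ht _ => hfb x hx t ht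
      · simp [Set.indicator_of_notMem hx, hf0 x hx]
    · filter_upwards [hside] with x hx
      have hζx : Tendsto (fun t => ζ (x, t)) (𝓝[≠] ψ x) (𝓝 (ζ (x, ψ x))) :=
        ((hζ.continuous.comp (Continuous.prodMk_right x)).tendsto (ψ x)).mono_left
          nhdsWithin_le_nhds
      by_cases hxW : (x, ψ x) ∈ W
      · obtain ⟨β, hβ⟩ := hx hxW
        exact tendsto_integral_mul_rescale hηI hη0 hη1 (hζx.mul hβ).neg
      · have hx0 : (x, ψ x) ∉ tsupport ζ := fun h => hxW (hs h)
        have h1 : ∀ᶠ t in 𝓝 (ψ x), ζ (x, t) = 0 :=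
          ((Continuous.prodMk_right x).tendsto (ψ x)).eventually
            (notMem_tsupport_iff_eventuallyEq.1 hx0)
        refine tendsto_integral_mul_rescale (L := 0) hηI hη0 hη1 ?_
        refine tendsto_const_nhds.congr' ?_
        filter_upwards [nhdsWithin_le_nhds h1] with t ht
        simp [f, ht]

end Graph

/-! ### Surfaces as graphs -/

section Surface

variable {X : Type*} [NormedAddCommGroup X] [NormedSpace ℝ X]

/-- The implicit function theorem gives a local `ψ₀`; multiplying it by a bump equal to `1` near
`p.1` makes it globally `C¹` without changing the graph near `p`. -/
theorem exists_graph_of_fderiv_ne_zero [FiniteDimensional ℝ X] {Φ : X × ℝ → ℝ} {p : X × ℝ}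
    (hΦ : ContDiffAt ℝ 1 Φ p) (h0 : Φ p = 0) (ht : fderiv ℝ Φ p (0, 1) ≠ 0) :
    ∃ ψ : X → ℝ, ContDiff ℝ 1 ψ ∧ ∀ᶠ q in 𝓝 p, (Φ q = 0 ↔ q.2 = ψ q.1) := by
  have : CompleteSpace X := FiniteDimensional.complete ℝ X
  have hinv : (fderiv ℝ Φ p ∘L .inr ℝ X ℝ).IsInvertible := by
    refine ⟨ContinuousLinearEquiv.unitsEquivAut ℝ (Units.mk0 _ ht), ?_⟩
    ext
    simp
  have h1 := hΦ.eventually_apply_eq_iff_implicitFunction one_ne_zero hinv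
  have h2 := hΦ.contDiffAt_implicitFunction one_ne_zero hinv
  set ψ₀ := hΦ.implicitFunction one_ne_zero hinv
  obtain ⟨v, hv, hψv⟩ := h2.contDiffOn (m := 1) le_rfl (by simp)
  obtain ⟨ρ, hρ, hball⟩ := Metric.mem_nhds_iff.1 hv
  let b : ContDiffBump p.1 := ⟨ρ / 4, ρ / 2, by positivity, by linarith⟩
  refine ⟨fun x => b x * ψ₀ x, ?_, ?_⟩
  · rw [contDiff_iff_contDiffAt]
    intro x
    by_cases hx : x ∈ Metric.ball p.1 ρ
    · exact b.contDiff.contDiffAt.mul (hψv.contDiffAt (mem_of_superset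
        (Metric.isOpen_ball.mem_nhds hx) hball))
    · have hx' : x ∉ tsupport b := by
        rw [b.tsupport_eq]
        intro h
        refine hx (Metric.closedBall_subset_ball ?_ h)
        simp only [b]
        linarith
      refine (contDiffAt_const (c := (0 : ℝ))).congr_of_eventuallyEq ?_
      filter_upwards [notMem_tsupport_iff_eventuallyEq.1 hx'] with y hy
      simp [hy]
  · have h3 : ∀ᶠ q : X × ℝ in 𝓝 p, q.1 ∈ Metric.ball p.1 (ρ / 4) :=
      continuous_fst.continuousAt.eventually_mem (Metric.ball_mem_nhds _ (by positivity))
    filter_upwards [h1, h3] with q hq hqb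
    rw [h0] at hq
    rw [hq, b.one_of_mem_closedBall (Metric.ball_subset_closedBall hqb), one_mul, eq_comm]

/-- Along `γ` the function `Φ` starts from `0` with positive derivative, so it is positive for small
positive parameters. -/
theorem tendsto_nhdsWithin_side {Φ : X × ℝ → ℝ} {p : X × ℝ} (hΦ : DifferentiableAt ℝ Φ p)
    (h0 : Φ p = 0) {γ : ℝ → X × ℝ} {v : X × ℝ} (hγ : HasDerivAt γ v 0) (hγ0 : γ 0 = p)
    (hv : 0 < fderiv ℝ Φ p v) : Tendsto γ (𝓝[>] 0) (𝓝[{q | 0 < Φ q}] p) := by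
  refine tendsto_nhdsWithin_iff.2 ⟨?_, ?_⟩
  · rw [← hγ0]
    exact hγ.continuousAt.tendsto.mono_left nhdsWithin_le_nhds
  · have hd : HasDerivAt (fun s => Φ (γ s)) (fderiv ℝ Φ p v) 0 := by
      subst hγ0
      exact hΦ.hasFDerivAt.comp_hasDerivAt 0 hγ
    have h1 := hd.tendsto_slope_zero_right.eventually_const_lt hv
    filter_upwards [h1, self_mem_nhdsWithin] with s hs hs0
    simp only [zero_add, hγ0, h0, sub_zero, smul_eq_mul] at hs
    exact (mul_pos_iff_of_pos_left (inv_pos.2 hs0)).1 hs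

theorem fderiv_graph_tangent {Φ : X × ℝ → ℝ} {p : X × ℝ} {ψ : X → ℝ}
    (hΦ : DifferentiableAt ℝ Φ p) (hψ : DifferentiableAt ℝ ψ p.1)
    (h : ∀ᶠ q in 𝓝 p, (Φ q = 0 ↔ q.2 = ψ q.1)) (h0 : Φ p = 0) (v : X) :
    fderiv ℝ Φ p (v, fderiv ℝ ψ p.1 v) = 0 := by
  have hp : p = (p.1, ψ p.1) := Prod.ext rfl (h.self_of_nhds.1 h0)
  have h1 : HasFDerivAt (fun x => (x, ψ x))
      ((ContinuousLinearMap.id ℝ X).prod (fderiv ℝ ψ p.1)) p.1 :=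
    (hasFDerivAt_id p.1).prodMk hψ.hasFDerivAt
  have hΦ' : HasFDerivAt Φ (fderiv ℝ Φ p) (p.1, ψ p.1) := hp ▸ hΦ.hasFDerivAt
  have h2 := hΦ'.comp p.1 h1
  have h3 : (Φ ∘ fun x => (x, ψ x)) =ᶠ[𝓝 p.1] fun _ => 0 := by
    have hc : Tendsto (fun x => (x, ψ x)) (𝓝 p.1) (𝓝 p) := by
      have := h1.continuousAt.tendsto
      rwa [← hp] at this
    filter_upwards [hc.eventually h] with x hx
    exact hx.2 rfl
  have h4 := h2.unique ((hasFDerivAt_const (0 : ℝ) p.1).congr_of_eventuallyEq h3)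
  simpa using DFunLike.congr_fun h4 v

/-- Near `p` the set `S` is a non-vertical `C¹` surface, and the component of `V` normal to the
surface is continuous across it at `p`. -/
def IsTransmissionPoint (S : Set (X × ℝ)) (V : X × ℝ → X × ℝ) (p : X × ℝ) : Prop :=
  ∃ Φ : X × ℝ → ℝ, ContDiffAt ℝ 1 Φ p ∧ (∀ᶠ q in 𝓝 p, (q ∈ S ↔ Φ q = 0)) ∧
    fderiv ℝ Φ p (0, 1) < 0 ∧ ∃ a b : X × ℝ, Tendsto V (𝓝[{q | 0 < Φ q}] p) (𝓝 a) ∧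
      Tendsto V (𝓝[{q | Φ q < 0}] p) (𝓝 b) ∧ fderiv ℝ Φ p a = fderiv ℝ Φ p b

/-- The function `Φ` varies with the point, while `ψ` is fixed on a neighbourhood. Both describe the
same tangent plane, so `dΦ v = (v.2 - dψ v.1) * ∂_tΦ`; equality of `dΦ a` and `dΦ b` is thus
equality of the normal components relative to `ψ`. -/
theorem IsTransmissionPoint.tendsto {S : Set (X × ℝ)} {V : X × ℝ → X × ℝ} {ψ : X → ℝ} {x : X}
    (h : IsTransmissionPoint S V (x, ψ x)) (hψ : DifferentiableAt ℝ ψ x)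
    (hS : ∀ᶠ q in 𝓝 (x, ψ x), (q ∈ S ↔ q.2 = ψ q.1)) :
    ∃ β : ℝ, Tendsto (fun s => (V (x, s)).2 - fderiv ℝ ψ x (V (x, s)).1) (𝓝[≠] ψ x) (𝓝 β) := by
  obtain ⟨Φ, hΦ, hΦS, ht, a, b, ha, hb, hab⟩ := h
  have hd := hΦ.differentiableAt one_ne_zero
  have h0 : Φ (x, ψ x) = 0 := hΦS.self_of_nhds.1 (hS.self_of_nhds.2 rfl)
  have hgr : ∀ᶠ q in 𝓝 (x, ψ x), (Φ q = 0 ↔ q.2 = ψ q.1) := by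
    filter_upwards [hΦS, hS] with q h1 h2
    rw [← h1, h2]
  have htan := fderiv_graph_tangent hd hψ hgr h0
  have hdec (v : X × ℝ) : fderiv ℝ Φ (x, ψ x) v
      = (v.2 - fderiv ℝ ψ x v.1) * fderiv ℝ Φ (x, ψ x) (0, 1) := by
    have e : v = (v.1, fderiv ℝ ψ x v.1) + (v.2 - fderiv ℝ ψ x v.1) • ((0 : X), (1 : ℝ)) := by
      ext <;> simp
    conv_lhs => rw [e]
    rw [map_add, htan v.1, map_smul, smul_eq_mul, zero_add]
  have hab' : a.2 - fderiv ℝ ψ x a.1 = b.2 - fderiv ℝ ψ x b.1 := by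
    rw [hdec a, hdec b] at hab
    exact mul_right_cancel₀ ht.ne hab
  have hγ (σ : ℝ) : HasDerivAt (fun s : ℝ => (x, ψ x + σ * s)) ((0 : X), σ) 0 := by
    simpa using (hasDerivAt_const (0 : ℝ) x).prodMk
      (((hasDerivAt_id (0 : ℝ)).const_mul σ).const_add (ψ x))
  -- Since `∂_tΦ < 0`, the side `Φ > 0` is reached from below the graph and `Φ < 0` from above.
  have hlow : Tendsto (fun s : ℝ => (x, s)) (𝓝[<] ψ x) (𝓝[{q | 0 < Φ q}] (x, ψ x)) := by
    have h1 := tendsto_nhdsWithin_side hd h0 (hγ (-1)) (by simp) (by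
      rw [show ((0 : X), (-1 : ℝ)) = -(0, 1) by simp, map_neg]
      linarith)
    have h2 : Tendsto (fun s => ψ x - s) (𝓝[<] ψ x) (𝓝[>] 0) := by
      refine tendsto_nhdsWithin_iff.2 ⟨?_, ?_⟩
      · have : Tendsto (fun s => ψ x - s) (𝓝 (ψ x)) (𝓝 (ψ x - ψ x)) :=
          tendsto_const_nhds.sub tendsto_id
        rw [sub_self] at this
        exact this.mono_left nhdsWithin_le_nhds
      · filter_upwards [self_mem_nhdsWithin] with s hs
        exact sub_pos.2 (Set.mem_Iio.1 hs)
    refine (h1.comp h2).congr fun s => ?_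
    simp
  have hup : Tendsto (fun s : ℝ => (x, s)) (𝓝[>] ψ x) (𝓝[{q | Φ q < 0}] (x, ψ x)) := by
    have h1 := tendsto_nhdsWithin_side (Φ := fun q => - Φ q) hd.neg (by simp [h0]) (hγ 1)
      (by simp) (by
        rw [fderiv_fun_neg]
        simpa using ht)
    simp only [Left.neg_pos_iff] at h1
    have h2 : Tendsto (fun s => s - ψ x) (𝓝[>] ψ x) (𝓝[>] 0) := by
      refine tendsto_nhdsWithin_iff.2 ⟨?_, ?_⟩
      · have : Tendsto (fun s => s - ψ x) (𝓝 (ψ x)) (𝓝 (ψ x - ψ x)) :=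
          tendsto_id.sub tendsto_const_nhds
        rw [sub_self] at this
        exact this.mono_left nhdsWithin_le_nhds
      · filter_upwards [self_mem_nhdsWithin] with s hs
        exact sub_pos.2 (Set.mem_Ioi.1 hs)
    refine (h1.comp h2).congr fun s => ?_
    simp
  have hcont : Continuous fun v : X × ℝ => v.2 - fderiv ℝ ψ x v.1 := by fun_prop
  refine ⟨a.2 - fderiv ℝ ψ x a.1, ?_⟩
  rw [punctured_nhds_eq_nhdsWithin_sup_nhdsWithin]
  refine Tendsto.sup ?_ ?_
  · exact (hcont.tendsto a).comp (ha.comp hlow)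
  · rw [hab']
    exact (hcont.tendsto b).comp (hb.comp hup)

end Surface

/-! ### Null sets -/

variable {N : ℕ}

instance : (volume : Measure (SpaceTime N)).IsAddHaarMeasure :=
  inferInstanceAs ((volume : Measure (EuclideanSpace ℝ (Fin N))).prod
    (volume : Measure ℝ)).IsAddHaarMeasure

/-- Projection to `ℝ^N` with the sup norm is 1-Lipschitz, and there `N`-dimensional Hausdorff
measure is Lebesgue measure. Hence exceptional front points lie over a null set of `x`. -/
theorem volume_fst_image_eq_zero {A : Set (SpaceTime N)} (hA : μH[(N : ℝ)] A = 0) :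
    volume (Prod.fst '' A) = 0 := by
  let f : SpaceTime N → Fin N → ℝ := fun p => WithLp.ofLp p.1
  have hf : LipschitzWith 1 f := by
    have h := (PiLp.lipschitzWith_ofLp 2 (fun _ : Fin N => ℝ)).comp
      (LipschitzWith.prod_fst (α := EuclideanSpace ℝ (Fin N)) (β := ℝ))
    exact h.weaken (by simp)
  have h1 : volume (f '' A) = 0 := by
    rw [← hausdorffMeasure_pi_real, Fintype.card_fin]
    have := hf.hausdorffMeasure_image_le (Nat.cast_nonneg N) A
    simpa [hA] using this
  have h2 := (PiLp.volume_preserving_ofLp (Fin N)).quasiMeasurePreserving.preimage_null h1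
  refine measure_mono_null ?_ h2
  rintro _ ⟨p, hp, rfl⟩
  exact ⟨p, hp, rfl⟩

theorem volume_eq_zero_of_hausdorffMeasure_eq_zero {A : Set (SpaceTime N)}
    (hA : μH[(N : ℝ)] A = 0) : volume A = 0 := by
  have h : (volume : Measure (SpaceTime N)) ((Prod.fst '' A) ×ˢ Set.univ) = 0 := by
    rw [Measure.volume_eq_prod, Measure.prod_prod, volume_fst_image_eq_zero hA, zero_mul]
  refine measure_mono_null (fun p hp => ?_) h
  exact ⟨⟨p, hp, rfl⟩, trivial⟩

/-- A set which near almost all of its points is a non-vertical `C¹` surface is Lebesgue-null. -/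
theorem volume_eq_zero_of_surface {S : Set (SpaceTime N)}
    (h : ∀ᵐ p ∂(μH[(N : ℝ)] : Measure (SpaceTime N)), p ∈ S → ∃ Φ : SpaceTime N → ℝ,
      ContDiffAt ℝ 1 Φ p ∧ (∀ᶠ q in 𝓝 p, (q ∈ S ↔ Φ q = 0)) ∧ fderiv ℝ Φ p (0, 1) < 0) :
    volume S = 0 := by
  have h1 := volume_eq_zero_of_hausdorffMeasure_eq_zero (ae_iff.1 h)
  set R := {p | ¬(p ∈ S → ∃ Φ : SpaceTime N → ℝ,
      ContDiffAt ℝ 1 Φ p ∧ (∀ᶠ q in 𝓝 p, (q ∈ S ↔ Φ q = 0)) ∧ fderiv ℝ Φ p (0, 1) < 0)}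
  have h2 : volume (S \ R) = 0 := by
    refine measure_null_of_locally_null _ fun p hp => ?_
    obtain ⟨Φ, hΦ, hS, ht⟩ := not_not.1 hp.2 hp.1
    obtain ⟨ψ, hψ, hgr⟩ := exists_graph_of_fderiv_ne_zero hΦ (hS.self_of_nhds.1 hp.1) ht.ne
    refine ⟨{q | q ∈ S ∧ q.2 = ψ q.1}, ?_, ?_⟩
    · filter_upwards [nhdsWithin_le_nhds hS, nhdsWithin_le_nhds hgr, self_mem_nhdsWithin]
        with q hq1 hq2 hq3
      exact ⟨hq3.1, hq2.1 (hq1.1 hq3.1)⟩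
    · exact measure_mono_null (fun q hq => hq.2) (measure_graph_eq_zero volume hψ.continuous)
  refine measure_mono_null (fun p hp => ?_) (measure_union_null h1 h2)
  by_cases hR : p ∈ R
  · exact Or.inl hR
  · exact Or.inr ⟨hp, hR⟩

/-! ### Divergence of fields with regular fronts -/

/-- Every point off `S` and every transmission point has a good neighbourhood; the remaining points
are too few to carry a divergence of a bounded field. -/
theorem hasWeakDiv_univ_of_transmission {S : Set (SpaceTime N)} {V : SpaceTime N → SpaceTime N}
    {g : SpaceTime N → ℝ} (hV : LocallyIntegrable V) (hg : LocallyIntegrable g)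
    (hVb : ∀ p, ∃ M : ℝ, ∀ᶠ q in 𝓝 p, q ∉ S → ‖V q‖ ≤ M) (hS : volume S = 0)
    (hdiv : ∀ p, p ∉ S → ∃ W ∈ 𝓝 p, HasWeakDiv volume V g W)
    (htr : ∀ᵐ p ∂(μH[(N : ℝ)] : Measure (SpaceTime N)), p ∈ S → IsTransmissionPoint S V p) :
    HasWeakDiv volume V g Set.univ := by
  have hreg (p : SpaceTime N) (hp : p ∈ S) (hpt : IsTransmissionPoint S V p) :
      ∃ W ∈ 𝓝 p, HasWeakDiv volume V g W := by
    obtain ⟨Φ, hΦ, hΦS, ht, -⟩ := hpt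
    obtain ⟨ψ, hψ, hgr⟩ := exists_graph_of_fderiv_ne_zero hΦ (hΦS.self_of_nhds.1 hp) ht.ne
    obtain ⟨M, hM⟩ := hVb p
    have hSψ : ∀ᶠ q in 𝓝 p, (q ∈ S ↔ q.2 = ψ q.1) := by
      filter_upwards [hΦS, hgr] with q h1 h2
      rw [h1, h2]
    obtain ⟨W, hW, hWo, hpW⟩ := mem_nhds_iff.1 (hSψ.and hM)
    refine ⟨W, hWo.mem_nhds hpW, ?_⟩
    -- For almost every `x` the graph point over `x`, if it lies in `W`, is a transmission point.
    have hx : ∀ᵐ x : EuclideanSpace ℝ (Fin N),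
        x ∉ Prod.fst '' {p | ¬(p ∈ S → IsTransmissionPoint S V p)} :=
      measure_eq_zero_iff_ae_notMem.1 (volume_fst_image_eq_zero (ae_iff.1 htr))
    refine HasWeakDiv.of_diff_graph (ν := volume) hψ hV hg
      (fun q hq hqψ => (hW hq).2 fun hqS => hqψ ((hW hq).1.1 hqS)) ?_ ?_
    · filter_upwards [hx] with x hx hxW
      have hxS : (x, ψ x) ∈ S := (hW hxW).1.2 rfl
      have hxt : IsTransmissionPoint S V (x, ψ x) := by
        by_contra hcon
        exact hx ⟨(x, ψ x), fun h => hcon (h hxS), rfl⟩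
      refine hxt.tendsto (hψ.differentiable one_ne_zero x) ?_
      filter_upwards [hWo.mem_nhds hxW] with q hq using (hW hq).1
    · exact HasWeakDiv.of_locally hV hg fun q hq =>
        hdiv q fun hqS => hq.2 ((hW hq.1).1.1 hqS)
  -- Defined by failure of a local property, `Z` is closed even though `S` need not be.
  let Z : Set (SpaceTime N) := {p | ¬∃ W ∈ 𝓝 p, HasWeakDiv volume V g W}
  have hZc : IsClosed Z := by
    rw [← isOpen_compl_iff, isOpen_iff_mem_nhds]
    intro p hp
    obtain ⟨W, hW, hdW⟩ := not_not.1 hp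
    filter_upwards [eventually_mem_nhds_iff.2 hW] with q hq
    exact not_not.2 ⟨W, hq, hdW⟩
  have hZS : Z ⊆ S := fun p hp => by
    by_contra hpS
    exact hp (hdiv p hpS)
  have hZ0 : μH[(N : ℝ)] Z = 0 := by
    refine measure_mono_null ?_ (ae_iff.1 htr)
    intro p hp h
    exact hp (hreg p (hZS hp) (h (hZS hp)))
  have hdim : Module.finrank ℝ (SpaceTime N) = N + 1 := by simp [SpaceTime]
  refine HasWeakDiv.of_compl hdim hV hg (fun p => ?_) hZc hZ0 (measure_mono_null hZS hS)
    (HasWeakDiv.of_locally hV hg fun p hp => not_not.1 hp)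
  obtain ⟨M, hM⟩ := hVb p
  refine ⟨M, _, hM, ?_⟩
  filter_upwards [measure_eq_zero_iff_ae_notMem.1 hS] with q hqS hq using hq hqS

/-! ### Partial derivatives -/

theorem timeDeriv_eq_fderiv {f : SpaceTime N → ℝ} {p : SpaceTime N}
    (hf : DifferentiableAt ℝ f p) : timeDeriv f p = fderiv ℝ f p (0, 1) := by
  have h1 : HasDerivAt (fun s : ℝ => (p.1, s)) ((0 : EuclideanSpace ℝ (Fin N)), (1 : ℝ)) p.2 :=
    (hasDerivAt_const p.2 p.1).prodMk (hasDerivAt_id p.2)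
  exact (HasFDerivAt.comp_hasDerivAt (x := p.2) (l := f) (f := fun s : ℝ => (p.1, s))
    hf.hasFDerivAt h1).deriv

theorem hasFDerivAt_slice {F : Type*} [NormedAddCommGroup F] [NormedSpace ℝ F]
    {f : SpaceTime N → F} {p : SpaceTime N} (hf : DifferentiableAt ℝ f p) :
    HasFDerivAt (fun y => f (y, p.2)) ((fderiv ℝ f p).comp (.inl ℝ _ ℝ)) p.1 :=
  HasFDerivAt.comp (x := p.1) (g := f) (f := fun y => (y, p.2)) hf.hasFDerivAt
    (hasFDerivAt_prodMk_left p.1 p.2)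

theorem inner_spaceGrad {f : SpaceTime N → ℝ} {p : SpaceTime N} (hf : DifferentiableAt ℝ f p)
    (n : EuclideanSpace ℝ (Fin N)) : inner ℝ n (spaceGrad f p) = fderiv ℝ f p (n, 0) := by
  rw [spaceGrad, gradient, (hasFDerivAt_slice hf).fderiv, real_inner_comm,
    InnerProductSpace.toDual_symm_apply]
  simp

/-- The coordinate directions of space-time, `none` standing for time. -/
def axis : Option (Fin N) → SpaceTime N
  | none => (0, 1)
  | some j => (EuclideanSpace.single j 1, 0)

/-- The coefficients of the wave operator. -/
def waveCoeff (c : ℝ) : Option (Fin N) → ℝ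
  | none => -(1 / c ^ 2)
  | some _ => 1

/-- The gradient with respect to the quadratic form of the wave operator. -/
def waveGrad (c : ℝ) (L : SpaceTime N →L[ℝ] ℝ) : SpaceTime N :=
  ∑ i, (waveCoeff c i * L (axis i)) • axis i

theorem continuous_waveGrad (c : ℝ) : Continuous (waveGrad (N := N) c) :=
  continuous_finsetSum _ fun _ _ => by fun_prop

/-- Symmetry of the quadratic form; it moves the operator from `du` onto the normal of the front. -/
theorem apply_waveGrad_comm (c : ℝ) (L L' : SpaceTime N →L[ℝ] ℝ) :
    L (waveGrad c L') = L' (waveGrad c L) := by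
  simp only [waveGrad, map_sum, map_smul, smul_eq_mul]
  exact Finset.sum_congr rfl fun i _ => by ring

theorem waveGrad_fderiv {f : SpaceTime N → ℝ} {p : SpaceTime N} (hf : DifferentiableAt ℝ f p)
    (c : ℝ) : waveGrad c (fderiv ℝ f p) = (spaceGrad f p, -(1 / c ^ 2) * timeDeriv f p) := by
  have h (j : Fin N) : fderiv ℝ f p (EuclideanSpace.single j 1, 0) = spaceGrad f p j := by
    rw [← inner_spaceGrad hf, EuclideanSpace.inner_single_left]
    simp
  simp only [waveGrad, Fintype.sum_option, waveCoeff, axis, one_mul, h, ← timeDeriv_eq_fderiv hf]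
  ext j
  · simp [Prod.fst_sum, Finset.sum_apply, Pi.single_apply]
  · simp [Prod.snd_sum]

/-- The divergence form of the wave operator, matching the field `waveGrad c (fderiv ℝ u ·)`. -/
theorem dAlembert_eq_sum {c : ℝ} {u : SpaceTime N → ℝ} {p : SpaceTime N}
    (hu : ContDiffAt ℝ 2 u p) : dAlembert c u p
      = ∑ i, fderiv ℝ (fun q => waveCoeff c i * fderiv ℝ u q (axis i)) p (axis i) := by
  have hev : ∀ᶠ q in 𝓝 p, DifferentiableAt ℝ u q := by
    filter_upwards [hu.eventually (by simp)] with q hq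
    exact hq.differentiableAt two_ne_zero
  have hD : DifferentiableAt ℝ (fderiv ℝ u) p :=
    (hu.fderiv_right (m := 1) (by norm_num)).differentiableAt one_ne_zero
  have hDw (w : SpaceTime N) : DifferentiableAt ℝ (fun q => fderiv ℝ u q w) p :=
    hD.clm_apply (differentiableAt_const w)
  have htime : timeDeriv (timeDeriv u) p = fderiv ℝ (fun q => fderiv ℝ u q (0, 1)) p (0, 1) := by
    rw [← timeDeriv_eq_fderiv (hDw _), timeDeriv, timeDeriv]
    refine Filter.EventuallyEq.deriv_eq ?_
    have ht : Tendsto (fun s : ℝ => (p.1, s)) (𝓝 p.2) (𝓝 p) :=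
      (Continuous.prodMk_right p.1).tendsto p.2
    filter_upwards [ht.eventually hev] with s hs using timeDeriv_eq_fderiv hs
  have hspace (j : Fin N) : iteratedFDeriv ℝ 2 (fun y => u (y, p.2)) p.1
      ![EuclideanSpace.single j 1, EuclideanSpace.single j 1]
      = fderiv ℝ (fun q => fderiv ℝ u q (axis (some j))) p (axis (some j)) := by
    have hx : Tendsto (fun y => (y, p.2)) (𝓝 p.1) (𝓝 p) :=
      (Continuous.prodMk_left p.2).tendsto p.1
    have h1 : fderiv ℝ (fun y => u (y, p.2))
        =ᶠ[𝓝 p.1] fun y => (fderiv ℝ u (y, p.2)).comp (.inl ℝ _ ℝ) := by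
      filter_upwards [hx.eventually hev] with y hy
      exact (hasFDerivAt_slice (p := (y, p.2)) hy).fderiv
    have h2 := (hasFDerivAt_slice hD).clm_comp
      (hasFDerivAt_const (ContinuousLinearMap.inl ℝ (EuclideanSpace ℝ (Fin N)) ℝ) p.1)
    rw [iteratedFDeriv_two_apply, h1.fderiv_eq, h2.fderiv, fderiv_clm_apply hD
      (differentiableAt_const _)]
    simp [axis]
  have hc (i : Option (Fin N)) :
      fderiv ℝ (fun q => waveCoeff c i * fderiv ℝ u q (axis i)) p (axis i)
        = waveCoeff c i * fderiv ℝ (fun q => fderiv ℝ u q (axis i)) p (axis i) := by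
    rw [fderiv_const_mul (hDw _)]
    simp
  simp only [hc]
  rw [Fintype.sum_option, dAlembert, htime,
    InnerProductSpace.laplacian_eq_iteratedFDeriv_orthonormalBasis _
      (EuclideanSpace.basisFun (Fin N) ℝ)]
  simp only [EuclideanSpace.basisFun_apply, hspace, waveCoeff, axis]
  ring_nf

/-! ### Jumps -/

theorem spaceGrad_ne_zero {c : ℝ} (hc : 0 < c) {S : Set (SpaceTime N)} {Φ : SpaceTime N → ℝ}
    {p : SpaceTime N} (h : IsCharacteristicSurfaceAt c S Φ p) : spaceGrad Φ p ≠ 0 := by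
  intro h0
  have h1 := h.characteristic
  rw [h0] at h1
  have h2 : timeDeriv Φ p / c ≠ 0 := div_ne_zero h.orientation.ne hc.ne'
  simp at h1
  exact h1.elim h.orientation.ne hc.ne'

theorem timeDeriv_eq_neg {c : ℝ} (hc : 0 < c) {S : Set (SpaceTime N)} {Φ : SpaceTime N → ℝ}
    {p : SpaceTime N} (h : IsCharacteristicSurfaceAt c S Φ p) :
    timeDeriv Φ p = -(c * ‖spaceGrad Φ p‖) := by
  have h1 := sq_eq_sq_iff_eq_or_eq_neg.1 h.characteristic
  have h2 : timeDeriv Φ p / c < 0 := div_neg_of_neg_of_pos h.orientation hc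
  rcases h1 with h1 | h1
  · exact absurd (norm_nonneg (spaceGrad Φ p)) (by linarith)
  · rw [div_eq_iff hc.ne'] at h1
    linarith

/-- Since `dΦ(n, 0) = ‖∇_xΦ‖ > 0`, the points `p ± ε n` lie on the sides `Φ > 0` and `Φ < 0`, so the
limits along `n` are the side limits. -/
theorem HasJump.eq_sub {c : ℝ} (hc : 0 < c) {S : Set (SpaceTime N)} {Φ f : SpaceTime N → ℝ}
    {p : SpaceTime N} {j a b : ℝ} (hp : p ∈ S) (h : IsCharacteristicSurfaceAt c S Φ p)
    (hj : HasJump f p (frontNormal Φ p) j)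
    (ha : Tendsto f (𝓝[{q | 0 < Φ q}] p) (𝓝 a)) (hb : Tendsto f (𝓝[{q | Φ q < 0}] p) (𝓝 b)) :
    a - b = j := by
  obtain ⟨f₁, f₂, h₁, h₂, h₃⟩ := hj
  have hd := h.smooth.differentiableAt one_ne_zero
  have h0 : Φ p = 0 := h.surface.self_of_nhds.1 hp
  have hg := norm_pos_iff.2 (spaceGrad_ne_zero hc h)
  have hpos : 0 < fderiv ℝ Φ p (frontNormal Φ p, 0) := by
    rw [← inner_spaceGrad hd, frontNormal, real_inner_smul_left, real_inner_self_eq_norm_sq]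
    positivity
  have hγ (σ : ℝ) : HasDerivAt (fun s : ℝ => (p.1 + (σ * s) • frontNormal Φ p, p.2))
      (σ • (frontNormal Φ p, (0 : ℝ))) 0 := by
    have h1 := ((((hasDerivAt_id (0 : ℝ)).const_mul σ).smul_const (frontNormal Φ p)).const_add
      p.1).prodMk (hasDerivAt_const (0 : ℝ) p.2)
    simpa using h1
  have t1 := tendsto_nhdsWithin_side hd h0 (hγ 1) (by simp) (by simpa using hpos)
  have t2 := tendsto_nhdsWithin_side (Φ := fun q => - Φ q) hd.neg (by simp [h0]) (hγ (-1))
    (by simp) (by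
      rw [fderiv_fun_neg, map_smul]
      simpa using hpos)
  simp only [Left.neg_pos_iff] at t2
  have e1 := tendsto_nhds_unique (h₁.congr fun ε => by simp) (ha.comp t1)
  have e2 := tendsto_nhds_unique (h₂.congr fun ε => by simp [sub_eq_add_neg]) (hb.comp t2)
  rw [← h₃, e1, e2]

theorem IsCharacteristicSurfaceAt.fderiv_time_neg {c : ℝ} {S : Set (SpaceTime N)}
    {Φ : SpaceTime N → ℝ} {p : SpaceTime N} (h : IsCharacteristicSurfaceAt c S Φ p) :
    fderiv ℝ Φ p (0, 1) < 0 :=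
  timeDeriv_eq_fderiv (h.smooth.differentiableAt one_ne_zero) ▸ h.orientation

theorem IsHadamardPoint.isTransmissionPoint_smul {c : ℝ} (hc : 0 < c) {S : Set (SpaceTime N)}
    {u : SpaceTime N → ℝ} {p : SpaceTime N} (hp : p ∈ S) (h : IsHadamardPoint c S u p)
    (w : SpaceTime N) : IsTransmissionPoint S (fun q => u q • w) p := by
  obtain ⟨Φ, hΦ, ⟨⟨a, ha⟩, ⟨b, hb⟩⟩, -, hj, -⟩ := h
  have hab : a = b := sub_eq_zero.1 (hj.eq_sub hc hp hΦ ha hb)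
  exact ⟨Φ, hΦ.smooth, hΦ.surface, hΦ.fderiv_time_neg, a • w, b • w, ha.smul_const w,
    hb.smul_const w, by rw [hab]⟩

/-- Here the characteristic equation and the second Hadamard condition meet: the normal component of
`A∇u` is the derivative of `u` along `A∇Φ`, hence a multiple of `∂_t u + c n·∇_x u`, whose jump is
zero. -/
theorem IsHadamardPoint.isTransmissionPoint_waveGrad {c : ℝ} (hc : 0 < c) {S : Set (SpaceTime N)}
    {u : SpaceTime N → ℝ} (hu : ∀ q, q ∉ S → DifferentiableAt ℝ u q) {p : SpaceTime N}
    (hp : p ∈ S) (h : IsHadamardPoint c S u p) :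
    IsTransmissionPoint S (fun q => waveGrad c (fderiv ℝ u q)) p := by
  obtain ⟨Φ, hΦ, -, ⟨⟨A, hA⟩, ⟨B, hB⟩⟩, -, hj⟩ := h
  have hg := spaceGrad_ne_zero hc hΦ
  have hgn := norm_pos_iff.2 hg
  set n := frontNormal Φ p
  have hlim {s : Set (SpaceTime N)} (hs : ∀ q ∈ s, Φ q ≠ 0) {L : SpaceTime N →L[ℝ] ℝ}
      (hL : Tendsto (fderiv ℝ u) (𝓝[s] p) (𝓝 L)) :
      Tendsto (fun q => timeDeriv u q + c * inner ℝ n (spaceGrad u q)) (𝓝[s] p)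
        (𝓝 (L (c • n, 1))) := by
    have h1 : Tendsto (fun q => fderiv ℝ u q (c • n, 1)) (𝓝[s] p) (𝓝 (L (c • n, 1))) :=
      ((ContinuousLinearMap.apply ℝ ℝ ((c • n, 1) : SpaceTime N)).continuous.tendsto L).comp hL
    refine h1.congr' ?_
    filter_upwards [self_mem_nhdsWithin, nhdsWithin_le_nhds hΦ.surface] with q hq hqS
    have hd := hu q fun h => hs q hq (hqS.1 h)
    rw [timeDeriv_eq_fderiv hd, inner_spaceGrad hd,
      show ((c • n, 1) : SpaceTime N) = (0, 1) + c • (n, 0) by simp, map_add, map_smul, smul_eq_mul]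
  have hAB : A (c • n, 1) = B (c • n, 1) := sub_eq_zero.1
    (hj.eq_sub hc hp hΦ (hlim (fun q hq => ne_of_gt hq) hA) (hlim (fun q hq => ne_of_lt hq) hB))
  -- From `∂_tΦ = -c ‖∇_xΦ‖` one gets `(∇_xΦ, -c⁻² ∂_tΦ) = (∇_xΦ, ‖∇_xΦ‖ / c)`.
  have hgrad : waveGrad c (fderiv ℝ Φ p) = (‖spaceGrad Φ p‖ / c) • (c • n, (1 : ℝ)) := by
    rw [waveGrad_fderiv (hΦ.smooth.differentiableAt one_ne_zero), timeDeriv_eq_neg hc hΦ,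
      Prod.smul_mk]
    refine Prod.ext ?_ ?_
    · simp only [n, frontNormal, smul_smul]
      have e : ‖spaceGrad Φ p‖ / c * (c * ‖spaceGrad Φ p‖⁻¹) = 1 := by field_simp
      rw [e, one_smul]
    · simp only [smul_eq_mul]
      field_simp
  refine ⟨Φ, hΦ.smooth, hΦ.surface, hΦ.fderiv_time_neg, waveGrad c A, waveGrad c B,
    ((continuous_waveGrad c).tendsto A).comp hA, ((continuous_waveGrad c).tendsto B).comp hB, ?_⟩
  rw [apply_waveGrad_comm, apply_waveGrad_comm _ _ B, hgrad, map_smul, map_smul, hAB]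

/-! ### Classical solutions -/

namespace IsClassicalSolution

variable {ι : Type*} {c : ℝ} {G : SpaceTime N → ℝ} {F : ι → Set (SpaceTime N)}
  {u : SpaceTime N → ℝ}

theorem ae_hadamard [Countable ι] (hu : IsClassicalSolution c G F u) :
    ∀ᵐ p ∂(μH[(N : ℝ)] : Measure (SpaceTime N)), p ∈ ⋃ i, F i →
      IsHadamardPoint c (⋃ i, F i) u p := by
  filter_upwards [ae_all_iff.2 hu.hadamard] with p hp hpS
  obtain ⟨i, hi⟩ := Set.mem_iUnion.1 hpS
  exact hp i hi

theorem volume_fronts [Countable ι] (hu : IsClassicalSolution c G F u) :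
    volume (⋃ i, F i) = 0 := by
  refine volume_eq_zero_of_surface ?_
  filter_upwards [hu.ae_hadamard] with p hp hpS
  obtain ⟨Φ, hΦ, -⟩ := hp hpS
  exact ⟨Φ, hΦ.smooth, hΦ.surface, hΦ.fderiv_time_neg⟩

theorem locallyIntegrable [Countable ι] (hu : IsClassicalSolution c G F u) :
    LocallyIntegrable u := by
  refine locallyIntegrable_of_bounded_off hu.volume_fronts
    (fun p hp => (hu.contDiffAt p hp).continuousAt) fun p => ?_
  obtain ⟨M, hM⟩ := hu.locallyBounded p
  exact ⟨M, hM.mono fun q hq hqS => (hq hqS).1⟩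

theorem continuousAt_fderiv (hu : IsClassicalSolution c G F u) {p : SpaceTime N}
    (hp : p ∉ ⋃ i, F i) : ContinuousAt (fderiv ℝ u) p :=
  (hu.contDiffAt p hp).continuousAt_fderiv two_ne_zero

theorem dAlembert_ae_eq [Countable ι] (hu : IsClassicalSolution c G F u) :
    dAlembert c u =ᵐ[volume] G := by
  filter_upwards [hu.equation, measure_eq_zero_iff_ae_notMem.1 hu.volume_fronts] with p h1 h2
  exact h1 h2

theorem locallyIntegrable_fderiv_apply [Countable ι] (hu : IsClassicalSolution c G F u)
    (w : SpaceTime N) : LocallyIntegrable (fun p => fderiv ℝ u p w) := by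
  refine locallyIntegrable_of_bounded_off hu.volume_fronts
    (fun p hp => (hu.continuousAt_fderiv hp).clm_apply continuousAt_const) fun p => ?_
  obtain ⟨M, hM⟩ := hu.locallyBounded p
  refine ⟨M * ‖w‖, hM.mono fun q hq hqS => ((fderiv ℝ u q).le_opNorm w).trans ?_⟩
  exact mul_le_mul_of_nonneg_right (hq hqS).2 (norm_nonneg w)

theorem hasWeakDiv_smul [Countable ι] (hc : 0 < c) (hu : IsClassicalSolution c G F u)
    (w : SpaceTime N) :
    HasWeakDiv volume (fun p => u p • w) (fun p => fderiv ℝ u p w) Set.univ := by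
  refine hasWeakDiv_univ_of_transmission (S := ⋃ i, F i)
    ?_ (hu.locallyIntegrable_fderiv_apply w) (fun p => ?_) hu.volume_fronts (fun p hp => ?_) ?_
  · refine locallyIntegrable_of_bounded_off hu.volume_fronts
      (fun p hp => (hu.contDiffAt p hp).continuousAt.smul continuousAt_const) fun p => ?_
    obtain ⟨M, hM⟩ := hu.locallyBounded p
    refine ⟨M * ‖w‖, hM.mono fun q hq hqS => ?_⟩
    rw [norm_smul]
    exact mul_le_mul_of_nonneg_right (hq hqS).1 (norm_nonneg w)
  · obtain ⟨M, hM⟩ := hu.locallyBounded p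
    refine ⟨M * ‖w‖, hM.mono fun q hq hqS => ?_⟩
    rw [norm_smul]
    exact mul_le_mul_of_nonneg_right (hq hqS).1 (norm_nonneg w)
  · refine ⟨_, (hu.contDiffAt p hp).eventually (by simp), ?_⟩
    simpa using hasWeakDiv_sum_of_contDiffAt (μ := volume) (ι := Unit) (f := fun _ => u)
      (U := {q | ContDiffAt ℝ 2 u q})
      (fun _ q (hq : ContDiffAt ℝ 2 u q) => hq.of_le (by norm_num)) fun _ => w
  · filter_upwards [hu.ae_hadamard] with p hp hpS
    exact (hp hpS).isTransmissionPoint_smul hc hpS w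

theorem hasWeakDiv_waveGrad [Countable ι] (hc : 0 < c) (hG : LocallyIntegrable G)
    (hu : IsClassicalSolution c G F u) :
    HasWeakDiv volume (fun p => waveGrad c (fderiv ℝ u p)) G Set.univ := by
  have hb (p : SpaceTime N) : ∃ M : ℝ, ∀ᶠ q in 𝓝 p, q ∉ ⋃ i, F i →
      ‖waveGrad c (fderiv ℝ u q)‖ ≤ M := by
    obtain ⟨M, hM⟩ := hu.locallyBounded p
    refine ⟨∑ i, ‖waveCoeff (N := N) c i‖ * (M * ‖axis (N := N) i‖) * ‖axis (N := N) i‖,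
      hM.mono fun q hq hqS => (norm_sum_le _ _).trans (Finset.sum_le_sum fun i _ => ?_)⟩
    rw [norm_smul, norm_mul]
    have := ((fderiv ℝ u q).le_opNorm (axis i)).trans
      (mul_le_mul_of_nonneg_right (hq hqS).2 (norm_nonneg _))
    gcongr
  refine hasWeakDiv_univ_of_transmission (S := ⋃ i, F i)
    ?_ hG hb hu.volume_fronts (fun p hp => ?_) ?_
  · exact locallyIntegrable_of_bounded_off hu.volume_fronts
      (fun p hp => (continuous_waveGrad c).continuousAt.comp (hu.continuousAt_fderiv hp)) hb
  · refine ⟨_, (hu.contDiffAt p hp).eventually (by simp), ?_⟩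
    refine (hasWeakDiv_sum_of_contDiffAt (μ := volume)
      (f := fun i q => waveCoeff c i * fderiv ℝ u q (axis i))
      (fun i q (hq : ContDiffAt ℝ 2 u q) => contDiffAt_const.mul
        ((hq.fderiv_right (by norm_num)).clm_apply contDiffAt_const)) axis).congr_ae ?_
    filter_upwards [hu.dAlembert_ae_eq] with q hq hq2
    rw [← hq, dAlembert_eq_sum hq2]
  · filter_upwards [hu.ae_hadamard] with p hp hpS
    exact (hp hpS).isTransmissionPoint_waveGrad hc
      (fun q hq => (hu.contDiffAt q hq).differentiableAt two_ne_zero) hpS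

end IsClassicalSolution

/-! ### Generalized functions -/

theorem lineDerivOp_testFunction_apply (w : SpaceTime N)
    (φ : 𝓓((⊤ : Opens (SpaceTime N)), ℝ)) (p : SpaceTime N) :
    (∂_{w} φ : 𝓓((⊤ : Opens (SpaceTime N)), ℝ)) p = fderiv ℝ φ p w := by
  rw [TestFunction.lineDerivOp_eq_lineDerivCLM ℝ, TestFunction.lineDerivCLM_apply_of_le (by simp),
    ((φ.contDiff.differentiable (by simp)) p).lineDeriv_eq_fderiv]

theorem regular_congr_ae {f g : SpaceTime N → ℝ} (hf : LocallyIntegrable f)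
    (hg : LocallyIntegrable g) (h : f =ᵐ[volume] g) : regular f = regular g := by
  ext φ
  rw [regular_apply hf, regular_apply hg]
  refine integral_congr_ae ?_
  filter_upwards [h] with p hp
  rw [hp]

theorem waveOp_genFun_apply (c : ℝ) (T : GenFun N) (φ : 𝓓((⊤ : Opens (SpaceTime N)), ℝ)) :
    waveOp N c T φ = T (waveOp N c φ) := by
  have h (w : SpaceTime N) : (∂_{w} (∂_{w} T : GenFun N) : GenFun N) φ
      = T (∂_{w} (∂_{w} φ : 𝓓((⊤ : Opens (SpaceTime N)), ℝ))) := by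
    simp
  rw [waveOp, waveOp, map_sub, map_sum, map_smul]
  simp [h]

theorem HasWeakDiv.testFunction {V : SpaceTime N → SpaceTime N} {g : SpaceTime N → ℝ}
    (h : HasWeakDiv volume V g Set.univ) (φ : 𝓓((⊤ : Opens (SpaceTime N)), ℝ)) :
    ∫ p, fderiv ℝ φ p (V p) = - ∫ p, φ p * g p :=
  h φ (φ.contDiff.of_le (by simp)) φ.hasCompactSupport (Set.subset_univ _)

namespace IsClassicalSolution

variable {ι : Type*} [Countable ι] {c : ℝ} {G : SpaceTime N → ℝ} {F : ι → Set (SpaceTime N)}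
  {u : SpaceTime N → ℝ}

theorem lineDeriv_regular (hc : 0 < c) (hu : IsClassicalSolution c G F u) (w : SpaceTime N) :
    ∂_{w} (regular u) = regular (fun p => fderiv ℝ u p w) := by
  ext φ
  rw [Distribution.lineDerivOp_apply_apply, map_neg, regular_apply hu.locallyIntegrable,
    regular_apply (hu.locallyIntegrable_fderiv_apply w)]
  have h := (hu.hasWeakDiv_smul hc w).testFunction φ
  simp only [map_smul, smul_eq_mul] at h
  simp only [lineDerivOp_testFunction_apply, h, neg_neg, mul_comm]

theorem isGeneralizedSolution (hc : 0 < c) (hG : LocallyIntegrable G)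
    (hu : IsClassicalSolution c G F u) : IsGeneralizedSolution c G (regular u) := by
  intro φ
  -- One derivative is moved back to `u` using the absence of layers in `∂_w û`, tested on `∂_w φ`.
  -- The weighted sum of these integrals is then the weak divergence identity for `A∇u`.
  have h2 (w : SpaceTime N) : regular u (∂_{w} (∂_{w} φ : 𝓓((⊤ : Opens (SpaceTime N)), ℝ)))
      = -∫ p, fderiv ℝ u p w * fderiv ℝ φ p w := by
    have h := DFunLike.congr_fun (hu.lineDeriv_regular hc w)
      (∂_{w} φ : 𝓓((⊤ : Opens (SpaceTime N)), ℝ))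
    rw [Distribution.lineDerivOp_apply_apply, map_neg,
      regular_apply (hu.locallyIntegrable_fderiv_apply w)] at h
    simp only [lineDerivOp_testFunction_apply] at h
    rw [← h, neg_neg]
  have hI (i : Option (Fin N)) : Integrable fun p =>
      waveCoeff c i * (fderiv ℝ u p (axis i) * fderiv ℝ φ p (axis i)) := by
    refine Integrable.const_mul ?_ _
    have h := integrable_fderiv_apply (φ.contDiff.of_le (m := 1) (by simp)) φ.hasCompactSupport
      (V := fun p => fderiv ℝ u p (axis i) • axis i) (μ := volume) ?_
    · simpa using h
    · intro p
      obtain ⟨s, hs, hint⟩ := hu.locallyIntegrable_fderiv_apply (axis i) p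
      exact ⟨s, hs, Integrable.smul_const hint _⟩
  have h := (hu.hasWeakDiv_waveGrad hc hG).testFunction φ
  simp only [waveGrad, map_sum, map_smul, smul_eq_mul, mul_assoc] at h
  rw [integral_finsetSum _ fun i _ => hI i] at h
  simp only [integral_const_mul, Fintype.sum_option, waveCoeff, axis, one_mul] at h
  rw [waveOp, map_sub, map_sum, map_smul]
  simp only [h2, smul_eq_mul, Finset.sum_neg_distrib]
  rw [regular_apply hG]
  simp only [mul_comm (G _)]
  linarith

end IsClassicalSolution

end WaveFronts

end

theorem mainTheorem11 {N : ℕ} {ι : Type*} [Countable ι] (c : ℝ) (hc : 0 < c)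
    (G : WaveFronts.SpaceTime N → ℝ) (hG : LocallyIntegrable G)
    (F : ι → Set (WaveFronts.SpaceTime N)) (u : WaveFronts.SpaceTime N → ℝ)
    (hu : WaveFronts.IsClassicalSolution c G F u) :
    -- `u` defines a regular generalized function, which is a generalized solution
    LocallyIntegrable u ∧
    WaveFronts.IsGeneralizedSolution c G (WaveFronts.regular u) ∧
    -- the generalized first derivatives and `□_c` of `u` are the classical ones: no layer terms
    (∀ w : WaveFronts.SpaceTime N, LocallyIntegrable (fun p => fderiv ℝ u p w) ∧
      ∂_{w} (WaveFronts.regular u) = WaveFronts.regular (fun p => fderiv ℝ u p w)) ∧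
    LocallyIntegrable (WaveFronts.dAlembert c u) ∧
    WaveFronts.waveOp N c (WaveFronts.regular u)
      = WaveFronts.regular (WaveFronts.dAlembert c u) := by
  -- No bound on second derivatives is assumed; integrability comes from `□_c u = G` almost
  -- everywhere, the fronts being null.
  have hdG : LocallyIntegrable (WaveFronts.dAlembert c u) := fun p => by
    obtain ⟨s, hs, h⟩ := hG p
    exact ⟨s, hs, h.congr (ae_restrict_of_ae hu.dAlembert_ae_eq.symm)⟩
  refine ⟨hu.locallyIntegrable, hu.isGeneralizedSolution hc hG,
    fun w => ⟨hu.locallyIntegrable_fderiv_apply w, hu.lineDeriv_regular hc w⟩, hdG, ?_⟩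
  rw [WaveFronts.regular_congr_ae hdG hG hu.dAlembert_ae_eq]
  ext φ
  rw [WaveFronts.waveOp_genFun_apply, hu.isGeneralizedSolution hc hG φ]
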